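/- For a skew-symmetric $2\times 2$ matrix valued kernel $K$ on $\mathbb R$ and $x_0\in\mathbb R$, the Fredholm Pfaffian on $\mathbb L^2(x_0,\infty)$ is $$\mathrm{Pf}[J+K]_{\mathbb L^2(x_0,\infty)}=1+\sum_{k\ge 1}\frac1{k!}\int_{(x_0,\infty)^k}\mathrm{Pf}\big[K(x_i,x_j)\big]_{i,j=1}^k\,dx_1\cdots dx_k ,$$ where $\mathrm{Pf}[M]=\frac{1}{2^kk!}\sum_{\sigma\in\mathcal S_{2k}}\mathrm{sign}(\sigma)M_{\sigma(1)\sigma(2)}\cdots M_{\sigma(2k-1)\sigma(2k)}$ and $[K(x_i,x_j)]$ is made of $k^2$ blocks of size $2\times2$. If the entry $K_{22}$ contains a multiple of $\delta'(x,y)$, the integral of the Pfaffian is defined by expanding $\mathrm{Pf}[K(x_i,x_j)]$ and letting the factors $\delta'(x_i,x_j)$ (which involve disjoint pairs of variables in each term) act by $\iint_{(x_0,\infty)^2} f(x,y)\,\delta'(x,y)\,dx\,dy=\int_{x_0}^\infty(\partial_yf-\partial_xf)(x,x)\,dx$. **Proposition.** Let $A:\mathbb R^2\to\mathbb R$ be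 smooth with $A(x,y)=-A(y,x)$, and let $$\mathbf A=\begin{pmatrix}A&-\partial_yA\\-\partial_xA&\partial_x\partial_yA\end{pmatrix},\qquad \mathbf B=\begin{pmatrix}A&-2\partial_yA\\-2\partial_xA&4\partial_x\partial_yA+\delta'\end{pmatrix}.$$ Let $x_0\in\mathbb R$ and assume that there are constants $C>0$ and $a>b\ge0$ such that for all $x,y>x_0$ $$|\mathbf A_{11}(x,y)|<Ce^{-ax-ay},\quad |\mathbf A_{12}(x,y)|<Ce^{-ax+by},\quad |\mathbf A_{22}(x,y)|<Ce^{bx+by}.$$ Then all integrals in the expansions of $\mathrm{Pf}[J-\mathbf A]$ and $\mathrm{Pf}[J-\mathbf B]$ on $\mathbb L^2(x_0,\infty)$ exist, both series converge absolutely, and $$\mathrm{Pf}[J-\mathbf A]_{\mathbb L^2(x_0,\infty)}=\mathrm{Pf}[J-\mathbf B]_{\mathbb L^2(x_0,\infty)}.$$ In particular, let $K^{\rm GSE}$ be the kernel with $$K^{\rm GSE}_{11}=\iint\frac{z-w}{4zw(z+w)}E,\quad K^{\rm GSE}_{12}=\iint\frac{z-w}{4z(z+w)}E,\quad K^{\rm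 GSE}_{22}=\iint\frac{z-w}{4(z+w)}E,\quad K^{\rm GSE}_{21}(x,y)=-K^{\rm GSE}_{12}(y,x),$$ where $E=e^{z^3/3+w^3/3-xz-yw}$ and $\iint$ stands for $\frac{1}{(2i\pi)^2}\int dz\int dw$, with $z$ and $w$ both running over the two rays from $1$ with angles $\pm\pi/3$, oriented from $1+\infty e^{-i\pi/3}$ to $1+\infty e^{i\pi/3}$. Then $K^{\rm GSE}$ is real, $A=K^{\rm GSE}_{11}$ is smooth and antisymmetric on $\mathbb R^2$, and $K^{\rm GSE}=\begin{pmatrix}A&-\partial_yA\\-\partial_xA&\partial_x\partial_yA\end{pmatrix}$. With $$K^\infty=\begin{pmatrix}A&-2\partial_yA\\-2\partial_xA&4\partial_x\partial_yA+\delta'\end{pmatrix}$$ one has, for every $x_0\in\mathbb R$, absolutely convergent expansions and $\mathrm{Pf}[J-K^{\rm GSE}]_{\mathbb L^2(x_0,\infty)}=\mathrm{Pf}[J-K^\infty]_{\mathbb L^2(x_0,\infty)}$. -/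

import Mathlib

open scoped ContDiff Nat
open MeasureTheory

noncomputable section

namespace FredholmPf

/-! ### Pfaffians and Fredholm Pfaffians of ordinary matrix kernels -/

/-- The Pfaffian of a `2k × 2k` matrix made of `k²` blocks of size `2 × 2`. The index `(l, 0)`
stands for `2l - 1` and `(l, 1)` for `2l` (with `l = 1, …, k`), so this is
`1 / (2^k k!) ∑_σ sign(σ) M_{σ(1)σ(2)} M_{σ(3)σ(4)} ⋯ M_{σ(2k-1)σ(2k)}`. -/
def pfaffian {k : ℕ} (M : Matrix (Fin k × Fin 2) (Fin k × Fin 2) ℝ) : ℝ :=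
  1 / (2 ^ k * (k ! : ℝ)) *
    ∑ σ : Equiv.Perm (Fin k × Fin 2),
      ((Equiv.Perm.sign σ : ℤ) : ℝ) * ∏ l : Fin k, M (σ (l, 0)) (σ (l, 1))

/-- A `2 × 2` matrix valued kernel on `ℝ`. -/
abbrev Kernel : Type := ℝ → ℝ → Matrix (Fin 2) (Fin 2) ℝ

/-- The `2k × 2k` matrix with `2 × 2` blocks `K (x i) (x j)`. -/
def blockMatrix (K : Kernel) {k : ℕ} (x : Fin k → ℝ) :
    Matrix (Fin k × Fin 2) (Fin k × Fin 2) ℝ :=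
  Matrix.of fun p q => K (x p.1) (x q.1) p.2 q.2

/-- `1 / k! ∫_{S^k} Pf [K(x_i, x_j)] dx_1 ⋯ dx_k`. For `k = 0` this is `1`. -/
def fredholmTerm (K : Kernel) (S : Set ℝ) (k : ℕ) : ℝ :=
  1 / (k ! : ℝ) * ∫ x in Set.univ.pi (fun _ : Fin k => S), pfaffian (blockMatrix K x)

/-- The Fredholm Pfaffian `Pf (J + K)` on `L²(S)`. -/
def fredholmPfaffian (K : Kernel) (S : Set ℝ) : ℝ :=
  ∑' k : ℕ, fredholmTerm K S k

/-- All integrals in the expansion of `Pf (J + K)` on `L²(S)` exist, and the series converges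
absolutely (for real series, `Summable` is absolute convergence). -/
def FredholmConverges (K : Kernel) (S : Set ℝ) : Prop :=
  (∀ k : ℕ, IntegrableOn (fun x : Fin k → ℝ => pfaffian (blockMatrix K x))
    (Set.univ.pi fun _ => S)) ∧
  Summable fun k : ℕ => fredholmTerm K S k

/-! ### The distribution `δ'` -/

/-- `∏_{(i, j) ∈ P} (∂_{x_j} - ∂_{x_i}) F`. -/
def deltaPrimeDeriv {ι : Type} [Fintype ι] [DecidableEq ι] (P : List (ι × ι))
    (F : (ι → ℝ) → ℝ) : (ι → ℝ) → ℝ :=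
  P.foldr (fun p G x => lineDeriv ℝ G x (Pi.single p.2 1 - Pi.single p.1 1)) F

/-- Sends `j` to `i` for each `(i, j) ∈ P` and fixes every other index. -/
def identify {ι : Type} [DecidableEq ι] (P : List (ι × ι)) : ι → ι :=
  P.foldr (fun p f => Function.update f p.2 p.1) id

/-- The integrand which remains when `∏_{(i, j) ∈ P} δ'(x_i, x_j)` is applied to `F`, for a list
`P` of disjoint pairs of indices: `∏_{(i, j) ∈ P} (∂_{x_j} - ∂_{x_i}) F`, restricted to the
diagonals `x_j = x_i`. It is a function of the variables that remain when each `x_j` has been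
identified with `x_i`. -/
def deltaPrimeIntegrand {ι : Type} [Fintype ι] [DecidableEq ι] (P : List (ι × ι))
    (F : (ι → ℝ) → ℝ) (y : Set.range (identify P) → ℝ) : ℝ :=
  deltaPrimeDeriv P F fun i => y (Set.rangeFactorization (identify P) i)

/-- `∫_{S^ι} ∏_{(i, j) ∈ P} δ'(x_i, x_j) F(x) dx` for a list `P` of disjoint pairs of indices,
where `∫∫_{S²} f(x, y) δ'(x, y) dx dy = ∫_S (∂_y f - ∂_x f)(x, x) dx`. -/
def deltaPrimeIntegral {ι : Type} [Fintype ι] [DecidableEq ι] (S : Set ℝ) (P : List (ι × ι))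
    (F : (ι → ℝ) → ℝ) : ℝ :=
  ∫ y in Set.univ.pi (fun _ : Set.range (identify P) => S), deltaPrimeIntegrand P F y

/-! ### Fredholm Pfaffians of kernels involving `δ'` -/

/-- The distribution valued kernel `regular(x, y) + coeff * [[0, 0], [0, δ'(x, y)]]`. -/
structure DeltaKernel where
  /-- the function part -/
  regular : Kernel
  /-- the coefficient of `δ'` in the entry `22` -/
  coeff : ℝ

instance : Neg DeltaKernel := ⟨fun B => ⟨-B.regular, -B.coeff⟩⟩

/-- The factors, in the summand of the Pfaffian with index `σ`, whose row and column both are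
second rows and columns of a `2 × 2` block. These are the factors
`regular_{22}(x_i, x_j) + coeff * δ'(x_i, x_j)`; a choice `D` of `δ'` is possible in these only. -/
def Admissible {k : ℕ} (σ : Equiv.Perm (Fin k × Fin 2)) (D : Finset (Fin k)) : Prop :=
  ∀ l ∈ D, (σ (l, 0)).2 = 1 ∧ (σ (l, 1)).2 = 1

instance {k : ℕ} (σ : Equiv.Perm (Fin k × Fin 2)) : DecidablePred (Admissible σ) :=
  fun D => inferInstanceAs (Decidable (∀ l ∈ D, (σ (l, 0)).2 = 1 ∧ (σ (l, 1)).2 = 1))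

/-- The list of the pairs `(i, j)` such that `δ'(x_i, x_j)` is taken from a factor in `D`.
They are disjoint if `D` is admissible. -/
def deltaPairs {k : ℕ} (σ : Equiv.Perm (Fin k × Fin 2)) (D : Finset (Fin k)) :
    List (Fin k × Fin k) :=
  ((List.finRange k).filter fun l => l ∈ D).map fun l => ((σ (l, 0)).1, (σ (l, 1)).1)

namespace DeltaKernel

/-- The product of the function parts of the factors that are not in `D`. -/
def regularProd (B : DeltaKernel) {k : ℕ} (σ : Equiv.Perm (Fin k × Fin 2))
    (D : Finset (Fin k)) (x : Fin k → ℝ) : ℝ :=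
  ∏ l ∈ Dᶜ, blockMatrix B.regular x (σ (l, 0)) (σ (l, 1))

/-- `∫_{S^k} Pf [B(x_i, x_j)] dx_1 ⋯ dx_k`: the Pfaffian is expanded into products of entries,
each product is multiplied out into terms
`coeff^{#D} ∏_{l ∈ D} δ'(x_{i_l}, x_{j_l}) ∏_{l ∉ D} regular(⋯)`, and `δ'` acts in each term on the
function it is multiplied with. -/
def pfaffianIntegral (B : DeltaKernel) (S : Set ℝ) (k : ℕ) : ℝ :=
  1 / (2 ^ k * (k ! : ℝ)) *
    ∑ σ : Equiv.Perm (Fin k × Fin 2), ((Equiv.Perm.sign σ : ℤ) : ℝ) *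
      ∑ D : Finset (Fin k) with Admissible σ D,
        B.coeff ^ D.card * deltaPrimeIntegral S (deltaPairs σ D) (B.regularProd σ D)

/-- `1 / k! ∫_{S^k} Pf [B(x_i, x_j)] dx_1 ⋯ dx_k`. For `k = 0` this is `1`. -/
def fredholmTerm (B : DeltaKernel) (S : Set ℝ) (k : ℕ) : ℝ :=
  1 / (k ! : ℝ) * B.pfaffianIntegral S k

/-- The Fredholm Pfaffian `Pf (J + B)` on `L²(S)`. -/
def fredholmPfaffian (B : DeltaKernel) (S : Set ℝ) : ℝ :=
  ∑' k : ℕ, B.fredholmTerm S k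

/-- All integrals in the expansion of `Pf (J + B)` on `L²(S)` exist, and the series converges
absolutely. -/
def FredholmConverges (B : DeltaKernel) (S : Set ℝ) : Prop :=
  (∀ (k : ℕ) (σ : Equiv.Perm (Fin k × Fin 2)) (D : Finset (Fin k)), Admissible σ D →
    IntegrableOn (deltaPrimeIntegrand (deltaPairs σ D) (B.regularProd σ D))
      (Set.univ.pi fun _ => S)) ∧
  Summable fun k : ℕ => B.fredholmTerm S k

end DeltaKernel

/-! ### The kernels `𝐀` and `𝐁` built from a scalar kernel `A` -/

/-- `∂_x A (x, y)` -/
def partialX (A : ℝ → ℝ → ℝ) (x y : ℝ) : ℝ := deriv (fun s => A s y) x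

/-- `∂_y A (x, y)` -/
def partialY (A : ℝ → ℝ → ℝ) (x y : ℝ) : ℝ := deriv (fun t => A x t) y

/-- `[[A, -∂_y A], [-∂_x A, ∂_x ∂_y A]]` -/
def kernelA (A : ℝ → ℝ → ℝ) : Kernel := fun x y =>
  !![A x y, -partialY A x y; -partialX A x y, partialX (partialY A) x y]

/-- `[[A, -2 ∂_y A], [-2 ∂_x A, 4 ∂_x ∂_y A + δ']]` -/
def kernelB (A : ℝ → ℝ → ℝ) : DeltaKernel where
  regular := fun x y =>
    !![A x y, -2 * partialY A x y; -2 * partialX A x y, 4 * partialX (partialY A) x y]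
  coeff := 1

/-- The exponential decay bounds, on `S × S`. -/
def ExpDecayOn (K : Kernel) (S : Set ℝ) : Prop :=
  ∃ C a b : ℝ, 0 < C ∧ 0 ≤ b ∧ b < a ∧ ∀ x ∈ S, ∀ y ∈ S,
    |K x y 0 0| < C * Real.exp (-a * x - a * y) ∧
    |K x y 0 1| < C * Real.exp (-a * x + b * y) ∧
    |K x y 1 1| < C * Real.exp (b * x + b * y)

/-! ### The GSE kernel -/

/-- `1 / (2 i π) ∫ f(z) dz` along the two rays which depart from `a` with angles `θ` and `-θ`,
oriented from `a + ∞ e^{-iθ}` to `a + ∞ e^{iθ}`. -/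
def rayIntegral (a : ℂ) (θ : ℝ) (f : ℂ → ℂ) : ℂ :=
  1 / (2 * Real.pi * Complex.I) *
    ((∫ t in Set.Ioi (0 : ℝ), f (a + t * Complex.exp (θ * Complex.I)) *
        Complex.exp (θ * Complex.I)) -
      ∫ t in Set.Ioi (0 : ℝ), f (a + t * Complex.exp (-θ * Complex.I)) *
        Complex.exp (-θ * Complex.I))

/-- `∫ dz ∫ dw g(z, w) exp (z³/3 + w³/3 - x z - y w)`, both integrals along the rays from `1` with
angles `± π/3`, and with a factor `1 / (2 i π)` each. -/
def airyDoubleIntegral (g : ℂ → ℂ → ℂ) (x y : ℝ) : ℂ :=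
  rayIntegral 1 (Real.pi / 3) fun z => rayIntegral 1 (Real.pi / 3) fun w =>
    g z w * Complex.exp (z ^ 3 / 3 + w ^ 3 / 3 - x * z - y * w)

/-- The entry `11` of the GSE kernel. -/
def gse11 (x y : ℝ) : ℂ :=
  airyDoubleIntegral (fun z w => (z - w) / (4 * z * w * (z + w))) x y

/-- The entry `12` of the GSE kernel. -/
def gse12 (x y : ℝ) : ℂ :=
  airyDoubleIntegral (fun z w => (z - w) / (4 * z * (z + w))) x y

/-- The entry `22` of the GSE kernel. -/
def gse22 (x y : ℝ) : ℂ :=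
  airyDoubleIntegral (fun z w => (z - w) / (4 * (z + w))) x y

/-- The GSE kernel, given by complex contour integrals. -/
def gseContourKernel (x y : ℝ) : Matrix (Fin 2) (Fin 2) ℂ :=
  !![gse11 x y, gse12 x y; -gse12 y x, gse22 x y]

/-- The GSE kernel as a real kernel (the contour integrals are real). -/
def kernelGSE : Kernel := fun x y => (gseContourKernel x y).map Complex.re

/-- The entry `11` of the GSE kernel, as a real kernel. -/
def scalarGSE (x y : ℝ) : ℝ := kernelGSE x y 0 0

/-- The kernel `K^∞ = [[A, -2 ∂_y A], [-2 ∂_x A, 4 ∂_x ∂_y A + δ']]` with `A = K^GSE_11`. -/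
def kernelInfinity : DeltaKernel := kernelB scalarGSE

end FredholmPf

end

/-! Put `K = -𝐀`. The function part of `-𝐁` is `K` with a factor 2 for each second row and each
second column, and the coefficient of `δ'` is `c = -1`. Since the second row (column) of `K` is
minus the derivative of the first, a term with factors `δ'` collapses to monomials of a Pfaffian of
`K` in fewer variables.

Take a term in `k` variables with `m` factors `δ'`. They occupy the second slots of `2m` variables,
so each of these variables occurs only once more, in its first slot. Applying `∂_{x_j} - ∂_{x_i}`
turns one of two first slots into a second slot, and setting `x_j = x_i` merges the pair into one
variable having both slots. What remains are monomials in `n = k - m` variables. By `sign_assemble`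
and `sign_flip`, after summation over permutations both choices of the differentiated slot
contribute equally, a factor 2 for each `δ'`; each of the `k - 2m` untouched variables gives another
2 through its second slot. Counting positions and variables of the `δ'` yields
(`fredholmTerm_eq_sum_antidiagonal`) `term_k(-𝐁) = ∑_{n + m = k} c^m 2^{n-m} (n choose m)
term_n(K)`. For fixed `n` the sum over `m` of the coefficients is `(2 + c)^n = 1`, which is the
asserted equality. The rearrangement requires `∑ 3^n |term_n(K)| < ∞`; Hadamard's inequality
provides `|term_n(K)| ≤ R^n n^{n/2} / n!`.

For the GSE kernel, `K_11` is a two-variable Laplace transform of a density that decays faster than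
any exponential. Hence it is smooth, differentiation multiplies the density by `-z` or `-w`, which
produces the other entries, and `Re z, Re w ≥ 1` on the contour gives the decay. Reality comes from
the conjugation symmetry of the contour, antisymmetry from exchanging `z` and `w`. -/

noncomputable section

namespace FredholmPf

/-! ### Permutations with prescribed values on the positions of the `δ'` factors -/

section Assemble

variable {α β V : Type}

/-- The positions `α ⊕ β × Fin 2`, doubled: those in `β × {1}` are split off. -/
def positionEquiv (α β : Type) :
    ((α ⊕ β × Fin 2) × Fin 2) ≃ ((α ⊕ β) × Fin 2) ⊕ (β × Fin 2) where
  toFun q := match q with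
    | (Sum.inl a, s) => Sum.inl (Sum.inl a, s)
    | (Sum.inr (b, u), s) => if u = 0 then Sum.inl (Sum.inr b, s) else Sum.inr (b, s)
  invFun q := match q with
    | Sum.inl (Sum.inl a, s) => (Sum.inl a, s)
    | Sum.inl (Sum.inr b, s) => (Sum.inr (b, 0), s)
    | Sum.inr (b, s) => (Sum.inr (b, 1), s)
  left_inv := by
    rintro ⟨a | ⟨b, u⟩, s⟩
    · rfl
    · fin_cases u <;> rfl
  right_inv := by
    rintro (⟨a | b, s⟩ | ⟨b, s⟩) <;> simp

/-- Exchanges `((b, u), s)` and `((b, s), u)`. -/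
def twist (α β : Type) : Equiv.Perm ((α ⊕ β × Fin 2) × Fin 2) :=
  ((Equiv.sumProdDistrib α (β × Fin 2) (Fin 2)).trans
    (Equiv.sumCongr (Equiv.refl _) (((Equiv.prodAssoc β (Fin 2) (Fin 2)).trans
      (Equiv.prodCongrRight fun _ => Equiv.prodComm (Fin 2) (Fin 2))).trans
        (Equiv.prodAssoc β (Fin 2) (Fin 2)).symm))).trans
    (Equiv.sumProdDistrib α (β × Fin 2) (Fin 2)).symm

@[simp] lemma twist_inl (a : α) (s : Fin 2) :
    twist α β (Sum.inl a, s) = (Sum.inl a, s) := rfl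

@[simp] lemma twist_inr (b : β) (u s : Fin 2) :
    twist α β (Sum.inr (b, u), s) = (Sum.inr (b, s), u) := rfl

/-- The permutation of `V × Fin 2` which, up to the labellings `π` of positions and `τ` of
variables, puts the slots `(b, 0), (b, 1)` of the `δ'` factors in the positions `(b, 1)`, and
arranges the remaining slots according to `ρ`. -/
def assemble (π τ : (α ⊕ β × Fin 2) ≃ V) (ρ : Equiv.Perm ((α ⊕ β) × Fin 2)) :
    Equiv.Perm (V × Fin 2) :=
  (π.prodCongr (Equiv.refl (Fin 2))).symm.trans
    ((((positionEquiv α β).trans (Equiv.Perm.sumCongr ρ 1)).trans (positionEquiv α β).symm).trans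
      ((twist α β).trans (τ.prodCongr (Equiv.refl (Fin 2)))))

/-- The slot of `V × Fin 2` with the given reduced label. -/
def slot (τ : (α ⊕ β × Fin 2) ≃ V) (q : (α ⊕ β) × Fin 2) : V × Fin 2 :=
  match q with
  | (Sum.inl a, s) => (τ (Sum.inl a), s)
  | (Sum.inr b, s) => (τ (Sum.inr (b, s)), 0)

/-- The inclusion of the reduced positions in all positions. -/
def keep : α ⊕ β → α ⊕ β × Fin 2
  | Sum.inl a => Sum.inl a
  | Sum.inr b => Sum.inr (b, 0)

/-- With `k = p + 2m`, there are `p + m` positions without `δ'` and `m` with it. Splitting the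
former into `α` and `β × {0}` lets the same type `α ⊕ β × Fin 2` label both positions and variables.
-/
lemma assemble_keep (π τ : (α ⊕ β × Fin 2) ≃ V) (ρ : Equiv.Perm ((α ⊕ β) × Fin 2))
    (l : α ⊕ β) (s : Fin 2) : assemble π τ ρ (π (keep l), s) = slot τ (ρ (l, s)) := by
  have h : ∀ q : (α ⊕ β) × Fin 2, (τ.prodCongr (Equiv.refl (Fin 2)))
      (twist α β ((positionEquiv α β).symm (Sum.inl q))) = slot τ q := by
    rintro ⟨a | b, s⟩ <;> rfl
  rw [← h]
  rcases l with a | b <;>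
  simp [assemble, keep, positionEquiv]

lemma assemble_inr_one (π τ : (α ⊕ β × Fin 2) ≃ V) (ρ : Equiv.Perm ((α ⊕ β) × Fin 2))
    (b : β) (s : Fin 2) :
    assemble π τ ρ (π (Sum.inr (b, 1)), s) = (τ (Sum.inr (b, s)), 1) := by
  simp [assemble, positionEquiv]

lemma assemble_injective (π τ : (α ⊕ β × Fin 2) ≃ V) :
    Function.Injective (assemble π τ) := by
  intro ρ ρ' h
  have hs : Function.Injective (slot τ) := by
    rintro ⟨a | b, s⟩ ⟨a' | b', s'⟩ h <;> simp_all [slot]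
  ext1 ⟨l, s⟩
  apply hs
  rw [← assemble_keep π τ ρ, ← assemble_keep π τ ρ', h]

/-- Read through the labellings and the inverse of `twist`, `σ` fixes all slots of the `δ'`
positions, so it is the sum of some `ρ` and the identity. -/
lemma exists_assemble_eq [Finite α] [Finite β] (π τ : (α ⊕ β × Fin 2) ≃ V)
    (σ : Equiv.Perm (V × Fin 2))
    (hσ : ∀ b s, σ (π (Sum.inr (b, 1)), s) = (τ (Sum.inr (b, s)), 1)) :
    ∃ ρ, assemble π τ ρ = σ := by
  let ξ : Equiv.Perm (((α ⊕ β) × Fin 2) ⊕ (β × Fin 2)) :=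
    (positionEquiv α β).symm.trans (((π.prodCongr (Equiv.refl (Fin 2))).trans
      (σ.trans ((τ.prodCongr (Equiv.refl (Fin 2))).symm.trans (twist α β).symm))).trans
        (positionEquiv α β))
  have hξ : ∀ q, ξ (Sum.inr q) = Sum.inr q := by
    rintro ⟨b, s⟩
    have h2 : (twist α β).symm (Sum.inr (b, s), 1) = (Sum.inr (b, 1), s) := by
      rw [Equiv.symm_apply_eq]; rfl
    simp [ξ, positionEquiv, hσ, h2]
  obtain ⟨⟨ρ, ρ'⟩, h⟩ := Equiv.Perm.mem_sumCongrHom_range_of_perm_mapsTo_inl (σ := ξ)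
    ((Equiv.Perm.perm_mapsTo_inl_iff_mapsTo_inr ξ).2 (by
      rintro _ ⟨q, rfl⟩; exact ⟨q, (hξ q).symm⟩))
  have h' : ξ = Equiv.Perm.sumCongr ρ 1 := by
    have hρ' : ρ' = 1 := by
      ext1 q
      have := hξ q
      rw [← h] at this
      simpa using this
    rw [← h, hρ']; rfl
  refine ⟨ρ, ?_⟩
  simp only [assemble, ← h', ξ]
  ext1 ⟨v, s⟩
  simp [Prod.map]

variable [Fintype α] [DecidableEq α] [Fintype β] [DecidableEq β] [Fintype V] [DecidableEq V]

/-- For each `b`, exchanging the two coordinates of `Fin 2 × Fin 2` is the single transposition of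
`(0, 1)` and `(1, 0)`. -/
lemma sign_twist : Equiv.Perm.sign (twist α β) = (-1) ^ Fintype.card β := by
  have h1 : twist α β = ((Equiv.sumProdDistrib α (β × Fin 2) (Fin 2)).trans
      (Equiv.Perm.sumCongr 1 (((Equiv.prodAssoc β (Fin 2) (Fin 2)).trans
        (Equiv.prodCongrRight fun _ =>
          (Equiv.prodComm (Fin 2) (Fin 2) : Equiv.Perm (Fin 2 × Fin 2)))).trans
        (Equiv.prodAssoc β (Fin 2) (Fin 2)).symm))).trans
      (Equiv.sumProdDistrib α (β × Fin 2) (Fin 2)).symm := rfl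
  have h2 : Equiv.Perm.sign (Equiv.prodComm (Fin 2) (Fin 2) : Equiv.Perm (Fin 2 × Fin 2)) = -1 := by
    decide
  rw [h1, Equiv.Perm.sign_trans_trans_symm, Equiv.Perm.sign_sumCongr,
    Equiv.Perm.sign_trans_trans_symm, Equiv.Perm.sign_prodCongrRight, map_one, one_mul]
  simp only [h2, Finset.prod_const, Finset.card_univ]

/-- A relabelling acts in the same way on both slots, so its sign is a square. Only `twist` and `ρ`
contribute. -/
lemma sign_assemble (π τ : (α ⊕ β × Fin 2) ≃ V) (ρ : Equiv.Perm ((α ⊕ β) × Fin 2)) :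
    Equiv.Perm.sign (assemble π τ ρ) = (-1) ^ Fintype.card β * Equiv.Perm.sign ρ := by
  have h : assemble π τ ρ = ((π.prodCongr (Equiv.refl (Fin 2))).symm.trans
      ((((((positionEquiv α β).trans (Equiv.Perm.sumCongr ρ 1)).trans
        (positionEquiv α β).symm).trans (twist α β))).trans
          (Equiv.prodCongrLeft fun _ : Fin 2 => (τ.trans π.symm : Equiv.Perm _)))).trans
            (π.prodCongr (Equiv.refl (Fin 2))) := by
    ext q : 1
    simp only [assemble, Equiv.trans_apply]
    generalize (twist α β) _ = t
    rcases t with ⟨t, s⟩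
    simp
  rw [h, Equiv.Perm.sign_symm_trans_trans, Equiv.Perm.sign_trans, Equiv.Perm.sign_trans,
    Equiv.Perm.sign_trans_trans_symm, Equiv.Perm.sign_prodCongrLeft, sign_twist,
    Equiv.Perm.sign_sumCongr]
  simp

end Assemble

/-! ### Monomials of a Pfaffian and their derivatives -/

section Monomial

variable {κ V W : Type} [Fintype κ]

/-- `∏_l K(f(l, 0), f(l, 1))`, where the pair `(v, s)` stands for the `s`-th row of the `v`-th
block. -/
def slotMonomial (K : Kernel) (f : κ × Fin 2 → V × Fin 2) (x : V → ℝ) : ℝ :=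
  ∏ l : κ, K (x (f (l, 0)).1) (x (f (l, 1)).1) (f (l, 0)).2 (f (l, 1)).2

lemma slotMonomial_comp (K : Kernel) (f : κ × Fin 2 → V × Fin 2) (c : V → W) (z : W → ℝ) :
    slotMonomial K f (fun v => z (c v)) =
      slotMonomial K (fun q => (c (f q).1, (f q).2)) z := rfl

/-- The kernel is smooth, and the second row (column) is the negative of the derivative of the
first. -/
structure IsDerivKernel (K : Kernel) : Prop where
  contDiff : ∀ s t, ContDiff ℝ ∞ fun p : ℝ × ℝ => K p.1 p.2 s t
  hasDerivAt_left : ∀ x y t, HasDerivAt (fun u => K u y 0 t) (-K x y 1 t) x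
  hasDerivAt_right : ∀ x y s, HasDerivAt (fun u => K x u s 0) (-K x y s 1) y

lemma IsDerivKernel.neg {K : Kernel} (hK : IsDerivKernel K) : IsDerivKernel (-K) where
  contDiff s t := (hK.contDiff s t).neg
  hasDerivAt_left x y t := (hK.hasDerivAt_left x y t).neg
  hasDerivAt_right x y s := (hK.hasDerivAt_right x y s).neg

lemma IsDerivKernel.contDiff_slotMonomial {K : Kernel} (hK : IsDerivKernel K) [Fintype V]
    (f : κ × Fin 2 → V × Fin 2) : ContDiff ℝ ∞ (slotMonomial K f) := by
  unfold slotMonomial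
  refine contDiff_prod fun l _ => ?_
  exact (hK.contDiff (f (l, 0)).2 (f (l, 1)).2).comp
    ((contDiff_apply ℝ ℝ (f (l, 0)).1).prodMk (contDiff_apply ℝ ℝ (f (l, 1)).1))

/-- The variable `v` occurs in the slot `q` only, so the product rule has a single term. This is the
situation of a `δ'` variable, whose other slot is occupied by `δ'` itself. -/
lemma IsDerivKernel.hasDerivAt_slotMonomial {K : Kernel} (hK : IsDerivKernel K)
    [DecidableEq κ] [DecidableEq V] (f : κ × Fin 2 → V × Fin 2) (q : κ × Fin 2) (v : V)
    (hq : f q = (v, 0)) (hne : ∀ q' ≠ q, (f q').1 ≠ v) (x : V → ℝ) :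
    HasDerivAt (fun u => slotMonomial K f (Function.update x v u))
      (-slotMonomial K (Function.update f q (v, 1)) x) (x v) := by
  obtain ⟨l, s⟩ := q
  have hsplit : ∀ (ψ : κ × Fin 2 → V × Fin 2) (y : V → ℝ), slotMonomial K ψ y =
      K (y (ψ (l, 0)).1) (y (ψ (l, 1)).1) (ψ (l, 0)).2 (ψ (l, 1)).2 *
      ∏ l' ∈ Finset.univ.erase l,
        K (y (ψ (l', 0)).1) (y (ψ (l', 1)).1) (ψ (l', 0)).2 (ψ (l', 1)).2 := fun ψ y =>
    (Finset.mul_prod_erase _ _ (Finset.mem_univ l)).symm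
  have hrest : ∀ u, ∏ l' ∈ Finset.univ.erase l, K (Function.update x v u (f (l', 0)).1)
        (Function.update x v u (f (l', 1)).1) (f (l', 0)).2 (f (l', 1)).2 =
      ∏ l' ∈ Finset.univ.erase l,
        K (x (f (l', 0)).1) (x (f (l', 1)).1) (f (l', 0)).2 (f (l', 1)).2 := by
    intro u
    refine Finset.prod_congr rfl fun l' hl' => ?_
    have hl : l' ≠ l := Finset.ne_of_mem_erase hl'
    rw [Function.update_of_ne (hne (l', 0) (by simp [hl])),
      Function.update_of_ne (hne (l', 1) (by simp [hl]))]
  have hrest' : ∏ l' ∈ Finset.univ.erase l, K (x (Function.update f (l, s) (v, 1) (l', 0)).1)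
        (x (Function.update f (l, s) (v, 1) (l', 1)).1)
        (Function.update f (l, s) (v, 1) (l', 0)).2 (Function.update f (l, s) (v, 1) (l', 1)).2 =
      ∏ l' ∈ Finset.univ.erase l,
        K (x (f (l', 0)).1) (x (f (l', 1)).1) (f (l', 0)).2 (f (l', 1)).2 := by
    refine Finset.prod_congr rfl fun l' hl' => ?_
    have hl : l' ≠ l := Finset.ne_of_mem_erase hl'
    rw [Function.update_of_ne (by simp [hl]), Function.update_of_ne (by simp [hl])]
  simp only [hsplit, hrest, hrest']
  rw [← neg_mul]
  refine HasDerivAt.mul_const ?_ _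
  have h01 : s = 0 ∨ s = 1 := by fin_cases s <;> simp
  rcases h01 with rfl | rfl
  · have h1 := hne (l, 1) (by simp)
    simpa [hq, h1, Function.update_of_ne] using
      hK.hasDerivAt_left (x v) (x (f (l, 1)).1) (f (l, 1)).2
  · have h1 := hne (l, 0) (by simp)
    simpa [hq, h1, Function.update_of_ne] using
      hK.hasDerivAt_right (x (f (l, 0)).1) (x v) (f (l, 0)).2

lemma IsDerivKernel.fderiv_slotMonomial_single {K : Kernel} (hK : IsDerivKernel K)
    [DecidableEq κ] [DecidableEq V] [Fintype V] (f : κ × Fin 2 → V × Fin 2) (q : κ × Fin 2)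
    (v : V) (hq : f q = (v, 0)) (hne : ∀ q' ≠ q, (f q').1 ≠ v) (x : V → ℝ) :
    fderiv ℝ (slotMonomial K f) x (Pi.single v 1) =
      -slotMonomial K (Function.update f q (v, 1)) x := by
  have h1 := hK.hasDerivAt_slotMonomial f q v hq hne x
  have hd : DifferentiableAt ℝ (slotMonomial K f) (Function.update x v (x v)) :=
    ((hK.contDiff_slotMonomial f).differentiable (by simp)).differentiableAt
  have h2 := hd.hasFDerivAt.comp_hasDerivAt (x v) (hasDerivAt_update x v (x v))
  rw [Function.update_eq_self] at h2
  exact h2.unique h1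

end Monomial

/-! ### The action of `δ'` on monomials -/

section DeltaPrime

variable {α β V : Type}

/-- As `slot`, but for `b ∈ L` the slot `(b, 1)` (if `b ∈ U`) or `(b, 0)` (if `b ∉ U`) is
differentiated. -/
def diffSlot [DecidableEq β] (τ : (α ⊕ β × Fin 2) ≃ V) (L U : Finset β)
    (q : (α ⊕ β) × Fin 2) : V × Fin 2 :=
  match q with
  | (Sum.inl a, s) => (τ (Sum.inl a), s)
  | (Sum.inr b, s) => (τ (Sum.inr (b, s)), if b ∈ L ∧ (s = 1 ↔ b ∈ U) then 1 else 0)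

lemma diffSlot_empty [DecidableEq β] (τ : (α ⊕ β × Fin 2) ≃ V) :
    diffSlot τ ∅ ∅ = slot τ := by
  ext1 ⟨a | b, s⟩ <;> simp [diffSlot, slot]

/-- The pair of variables of the `δ'` factor with label `b`. -/
def deltaPair (τ : (α ⊕ β × Fin 2) ≃ V) (b : β) : V × V :=
  (τ (Sum.inr (b, 0)), τ (Sum.inr (b, 1)))

/-- Each derivative brings the minus sign of `IsDerivKernel`. In `∂_{(b,1)} - ∂_{(b,0)}` this makes
the term where `(b, 0)` is differentiated positive and the one where `(b, 1)` is differentiated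
negative. -/
lemma lineDeriv_slotMonomial_diffSlot {K : Kernel} (hK : IsDerivKernel K) [Fintype α]
    [DecidableEq α] [Fintype β] [DecidableEq β] [Fintype V] [DecidableEq V]
    (τ : (α ⊕ β × Fin 2) ≃ V) (ρ : Equiv.Perm ((α ⊕ β) × Fin 2)) {L U : Finset β} {b : β}
    (hb : b ∉ L) (hU : U ⊆ L) (x : V → ℝ) :
    fderiv ℝ (slotMonomial K (diffSlot τ L U ∘ ρ)) x
        (Pi.single (deltaPair τ b).2 1 - Pi.single (deltaPair τ b).1 1) =
      slotMonomial K (diffSlot τ (insert b L) U ∘ ρ) x -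
        slotMonomial K (diffSlot τ (insert b L) (insert b U) ∘ ρ) x := by
  have hbU : b ∉ U := fun h => hb (hU h)
  have key : ∀ s : Fin 2, fderiv ℝ (slotMonomial K (diffSlot τ L U ∘ ρ)) x
      (Pi.single (τ (Sum.inr (b, s))) 1) = -slotMonomial K
        (Function.update (diffSlot τ L U ∘ ρ) (ρ.symm (Sum.inr b, s))
          (τ (Sum.inr (b, s)), 1)) x := by
    intro s
    refine hK.fderiv_slotMonomial_single _ _ _ (by simp [diffSlot, hb]) ?_ x
    intro q' hq'
    have hq : ρ q' ≠ (Sum.inr b, s) := by rwa [Ne, ← Equiv.eq_symm_apply]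
    revert hq
    rcases h : ρ q' with ⟨a' | b', s'⟩ <;> intro hq <;> simp [diffSlot, h] at hq ⊢
    exact hq
  have hup : ∀ (s : Fin 2) (U' : Finset β), (∀ b' ≠ b, (b' ∈ U' ↔ b' ∈ U)) →
      (s = 1 ↔ b ∈ U') → Function.update (diffSlot τ L U ∘ ρ) (ρ.symm (Sum.inr b, s))
          (τ (Sum.inr (b, s)), 1) = diffSlot τ (insert b L) U' ∘ ρ := by
    intro s U' h1 h2
    ext1 q
    by_cases hq : q = ρ.symm (Sum.inr b, s)
    · subst hq
      simp [diffSlot, h2]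
    · rw [Function.update_of_ne hq]
      have hq : ρ q ≠ (Sum.inr b, s) := by rwa [Ne, ← Equiv.eq_symm_apply]
      simp only [Function.comp_apply]
      revert hq
      rcases ρ q with ⟨a' | b', s'⟩ <;> intro hq
      · rfl
      · by_cases hbb : b' = b
        · subst hbb
          have hs : s' ≠ s := by simpa using hq
          have : ¬ (s' = 1 ↔ b' ∈ U') := by
            rw [← h2]
            fin_cases s <;> fin_cases s' <;> simp_all
          simp [diffSlot, hb, this]
        · simp [diffSlot, hbb, h1 b' hbb]
  rw [map_sub, deltaPair, key 0, key 1, hup 0 U (by simp) (by simpa using hbU),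
    hup 1 (insert b U) (by intro b' hb'; simp [hb']) (by simp)]
  ring

/-- `U` records the `δ'` factors whose second variable is the differentiated one; the others
differentiate their first. -/
lemma deltaPrimeDeriv_slotMonomial {K : Kernel} (hK : IsDerivKernel K) [Fintype α]
    [DecidableEq α] [Fintype β] [DecidableEq β] [Fintype V] [DecidableEq V]
    (τ : (α ⊕ β × Fin 2) ≃ V) (ρ : Equiv.Perm ((α ⊕ β) × Fin 2)) (c : ℝ) {L : List β}
    (hL : L.Nodup) :
    deltaPrimeDeriv (L.map (deltaPair τ)) (fun x => c * slotMonomial K (slot τ ∘ ρ) x) =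
      fun x => c * ∑ U ∈ L.toFinset.powerset,
        (-1) ^ U.card * slotMonomial K (diffSlot τ L.toFinset U ∘ ρ) x := by
  induction L with
  | nil => simp [deltaPrimeDeriv, diffSlot_empty]
  | cons b L ih =>
    obtain ⟨hb, hL⟩ := List.nodup_cons.1 hL
    have hb' : b ∉ L.toFinset := by simpa using hb
    specialize ih hL
    simp only [deltaPrimeDeriv, List.map_cons, List.foldr_cons] at ih ⊢
    rw [ih]
    ext1 x
    have hd : ∀ U : Finset β, DifferentiableAt ℝ
        (slotMonomial K (diffSlot τ L.toFinset U ∘ ρ)) x := fun U =>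
      ((hK.contDiff_slotMonomial _).differentiable (by simp)).differentiableAt
    have hd' : HasFDerivAt (fun x => c * ∑ U ∈ L.toFinset.powerset,
        (-1) ^ U.card * slotMonomial K (diffSlot τ L.toFinset U ∘ ρ) x)
        (c • ∑ U ∈ L.toFinset.powerset, ((-1 : ℝ) ^ U.card •
          fderiv ℝ (slotMonomial K (diffSlot τ L.toFinset U ∘ ρ)) x)) x :=
      (HasFDerivAt.fun_sum fun U _ => (hd U).hasFDerivAt.const_mul _).const_mul c
    rw [hd'.differentiableAt.lineDeriv_eq_fderiv, hd'.fderiv, List.toFinset_cons,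
      Finset.sum_powerset_insert hb', ← Finset.sum_add_distrib]
    simp only [smul_apply, sum_apply, smul_eq_mul]
    congr 1
    refine Finset.sum_congr rfl fun U hU => ?_
    have hU := Finset.mem_powerset.1 hU
    rw [lineDeriv_slotMonomial_diffSlot hK τ ρ hb' hU, Finset.card_insert_of_notMem
      (fun h => hb' (hU h))]
    ring

/-! ### The variables which remain after the action of `δ'` -/

/-- The reduced label of a variable. -/
def collapse : α ⊕ β × Fin 2 → α ⊕ β
  | Sum.inl a => Sum.inl a
  | Sum.inr (b, _) => Sum.inr b

lemma collapse_keep (q : α ⊕ β) : collapse (keep q) = q := by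
  rcases q with a | b <;> rfl

lemma identify_apply [DecidableEq α] [DecidableEq β] [DecidableEq V] (τ : (α ⊕ β × Fin 2) ≃ V) (L : List β)
    (t : α ⊕ β × Fin 2) :
    identify (L.map (deltaPair τ)) (τ t) =
      if ∃ b ∈ L, t = Sum.inr (b, 1) then τ (keep (collapse t)) else τ t := by
  induction L with
  | nil => simp [identify]
  | cons b L ih =>
    simp only [identify, List.map_cons, List.foldr_cons] at ih ⊢
    rw [Function.update_apply, ih]
    by_cases h : t = Sum.inr (b, 1)
    · subst h
      simp [deltaPair, keep, collapse]
    · have h' : τ t ≠ (deltaPair τ b).2 := by simpa [deltaPair] using h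
      simp [h', h]

lemma identify_apply_of_forall_mem [DecidableEq α] [DecidableEq β] [DecidableEq V]
    (τ : (α ⊕ β × Fin 2) ≃ V) {L : List β}
    (hL : ∀ b, b ∈ L) (t : α ⊕ β × Fin 2) :
    identify (L.map (deltaPair τ)) (τ t) = τ (keep (collapse t)) := by
  rw [identify_apply]
  rcases t with a | ⟨b, s⟩
  · simp [keep, collapse]
  · fin_cases s <;> simp [keep, collapse, hL]

/-- The reduced labels are in bijection with the variables which remain. -/
def keepEquiv [DecidableEq α] [DecidableEq β] [DecidableEq V] (τ : (α ⊕ β × Fin 2) ≃ V) (L : List β)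
    (hL : ∀ b, b ∈ L) : α ⊕ β ≃ Set.range (identify (L.map (deltaPair τ))) where
  toFun q := Set.rangeFactorization _ (τ (keep q))
  invFun v := collapse (τ.symm v)
  left_inv q := by
    simp [Set.rangeFactorization, identify_apply_of_forall_mem τ hL, collapse_keep]
  right_inv := by
    rintro ⟨_, v, rfl⟩
    obtain ⟨t, rfl⟩ := τ.surjective v
    simp [Set.rangeFactorization, identify_apply_of_forall_mem τ hL, collapse_keep]

lemma rangeFactorization_eq_keepEquiv [DecidableEq α] [DecidableEq β] [DecidableEq V]
    (τ : (α ⊕ β × Fin 2) ≃ V) (L : List β) (hL : ∀ b, b ∈ L) (v : V) :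
    Set.rangeFactorization (identify (L.map (deltaPair τ))) v =
      keepEquiv τ L hL (collapse (τ.symm v)) := by
  obtain ⟨t, rfl⟩ := τ.surjective v
  apply Subtype.ext
  simp [keepEquiv, Set.rangeFactorization, identify_apply_of_forall_mem τ hL, collapse_keep]

/-- Exchanges the slots `(b, 0)` and `(b, 1)` for `b ∉ U`. -/
def flip (α : Type) [DecidableEq β] (U : Finset β) : Equiv.Perm ((α ⊕ β) × Fin 2) :=
  Equiv.prodCongrRight fun q => match q with
    | Sum.inl _ => 1
    | Sum.inr b => if b ∈ U then 1 else Equiv.swap 0 1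

lemma sign_flip [Fintype α] [DecidableEq α] [Fintype β] [DecidableEq β] (U : Finset β) :
    Equiv.Perm.sign (flip α U) = (-1) ^ (Fintype.card β + U.card) := by
  have h : ∀ b : β, Equiv.Perm.sign (if b ∈ U then 1 else Equiv.swap (0 : Fin 2) 1) =
      -1 * (if b ∈ U then (-1 : ℤˣ) else 1) := by
    intro b; split_ifs <;> simp
  rw [flip, Equiv.Perm.sign_prodCongrRight, Fintype.prod_sum_type]
  simp only [map_one, Finset.prod_const_one, one_mul, h, Finset.prod_mul_distrib,
    Finset.prod_const, Finset.card_univ, pow_add, Finset.prod_ite_mem, Finset.univ_inter]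

/-- On the diagonal the two variables of `b` become one. If `b ∈ U`, the slot `(b, 1)` carries the
derivative, which is already the standard labelling; if `b ∉ U`, the two slots are interchanged.
This is `flip`. -/
lemma deltaPrimeIntegrand_slotMonomial {K : Kernel} (hK : IsDerivKernel K) [Fintype α]
    [DecidableEq α] [Fintype β] [DecidableEq β] [Fintype V] [DecidableEq V]
    (τ : (α ⊕ β × Fin 2) ≃ V) (ρ : Equiv.Perm ((α ⊕ β) × Fin 2)) (c : ℝ) {L : List β}
    (hL : L.Nodup) (hL' : ∀ b, b ∈ L)
    (y : Set.range (identify (L.map (deltaPair τ))) → ℝ) :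
    deltaPrimeIntegrand (L.map (deltaPair τ)) (fun x => c * slotMonomial K (slot τ ∘ ρ) x) y =
      c * ∑ U : Finset β, (-1) ^ U.card *
        slotMonomial K (flip α U * ρ) (fun q => y (keepEquiv τ L hL' q)) := by
  have hLu : L.toFinset = Finset.univ := by ext b; simp [hL']
  rw [deltaPrimeIntegrand, deltaPrimeDeriv_slotMonomial hK τ ρ c hL, hLu, Finset.powerset_univ]
  simp only [rangeFactorization_eq_keepEquiv τ L hL']
  congr 1
  refine Finset.sum_congr rfl fun U _ => ?_
  rw [slotMonomial_comp K _ (fun v => collapse (τ.symm v))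
    (fun q => y (keepEquiv τ L hL' q))]
  congr 2
  ext1 q
  simp only [Function.comp_apply, Equiv.Perm.mul_apply]
  rcases ρ q with ⟨a | b, s⟩
  · simp [diffSlot, flip, collapse]
  · by_cases hb : b ∈ U <;> fin_cases s <;> simp [diffSlot, flip, collapse, hb]

end DeltaPrime

/-! ### Integrals over products of copies of a set -/

section Pi

variable {κ ι : Type}

lemma measurableEquiv_piCongrLeft_symm_apply (e : κ ≃ ι) (y : ι → ℝ) :
    MeasurableEquiv.piCongrLeft (fun _ : κ => ℝ) e.symm y = fun q => y (e q) := by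
  ext1 q
  rw [MeasurableEquiv.coe_piCongrLeft]
  simpa using Equiv.piCongrLeft_apply_apply (fun _ : κ => ℝ) e.symm y (e q)

lemma preimage_piCongrLeft_symm_pi (e : κ ≃ ι) (S : Set ℝ) :
    MeasurableEquiv.piCongrLeft (fun _ : κ => ℝ) e.symm ⁻¹' Set.univ.pi (fun _ => S) =
      Set.univ.pi (fun _ => S) := by
  ext y
  simp only [Set.mem_preimage, measurableEquiv_piCongrLeft_symm_apply, Set.mem_univ_pi]
  exact e.forall_congr_left.trans (by simp)

variable [Fintype κ] [Fintype ι]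

lemma setIntegral_pi_comp_equiv (e : κ ≃ ι) (S : Set ℝ) (g : (κ → ℝ) → ℝ) :
    ∫ y in Set.univ.pi (fun _ : ι => S), g (fun q => y (e q)) =
      ∫ z in Set.univ.pi (fun _ : κ => S), g z := by
  have h := volume_measurePreserving_piCongrLeft (fun _ : κ => ℝ) e.symm
  rw [← h.setIntegral_preimage_emb (MeasurableEquiv.measurableEmbedding _) g,
    preimage_piCongrLeft_symm_pi]
  simp only [measurableEquiv_piCongrLeft_symm_apply]

lemma integrableOn_pi_comp_equiv (e : κ ≃ ι) {S : Set ℝ} {g : (κ → ℝ) → ℝ}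
    (hg : IntegrableOn g (Set.univ.pi fun _ => S)) :
    IntegrableOn (fun y : ι → ℝ => g (fun q => y (e q))) (Set.univ.pi fun _ => S) := by
  have h := ((volume_measurePreserving_piCongrLeft (fun _ : κ => ℝ)
    e.symm).integrableOn_comp_preimage (MeasurableEquiv.measurableEmbedding _)
      (s := Set.univ.pi fun _ => S)).2 hg
  rw [preimage_piCongrLeft_symm_pi] at h
  exact h.congr_fun_ae (by
    filter_upwards with y
    rw [Function.comp_apply, measurableEquiv_piCongrLeft_symm_apply])

/-- The entries `K_{st}(x, y)` are bounded by `C w_s(x) w_t(y)`, with `w_0 w_1` integrable. -/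
structure DominatedOn (K : Kernel) (S : Set ℝ) (C : ℝ) (w : Fin 2 → ℝ → ℝ) : Prop where
  measurableSet : MeasurableSet S
  integrableOn : IntegrableOn (fun x => w 0 x * w 1 x) S
  nonneg : 0 ≤ C
  pos : ∀ s x, 0 < w s x
  bound : ∀ x ∈ S, ∀ y ∈ S, ∀ s t, |K x y s t| ≤ C * (w s x * w t y)

lemma DominatedOn.neg {K : Kernel} {S : Set ℝ} {C : ℝ} {w : Fin 2 → ℝ → ℝ}
    (h : DominatedOn K S C w) : DominatedOn (-K) S C w where
  measurableSet := h.measurableSet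
  integrableOn := h.integrableOn
  nonneg := h.nonneg
  pos := h.pos
  bound x hx y hy s t := by simpa using h.bound x hx y hy s t

variable {K : Kernel} {S : Set ℝ} {C : ℝ} {w : Fin 2 → ℝ → ℝ}

lemma restrict_volume_pi (S : Set ℝ) : (volume : Measure (κ → ℝ)).restrict
    (Set.univ.pi fun _ => S) = Measure.pi fun _ => volume.restrict S := by
  rw [volume_pi, Measure.restrict_pi_pi]

lemma DominatedOn.integrableOn_prod (h : DominatedOn K S C w) :
    IntegrableOn (fun z : κ → ℝ => ∏ q, (w 0 (z q) * w 1 (z q))) (Set.univ.pi fun _ => S) := by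
  rw [IntegrableOn, restrict_volume_pi]
  exact Integrable.fintype_prod (f := fun _ x => w 0 x * w 1 x) fun _ => h.integrableOn

/-- A permutation uses every slot exactly once, so the weights multiply to the same product for all
`ρ`. -/
lemma DominatedOn.abs_slotMonomial_le (h : DominatedOn K S C w)
    (ρ : Equiv.Perm (κ × Fin 2)) {z : κ → ℝ} (hz : z ∈ Set.univ.pi fun _ => S) :
    |slotMonomial K ρ z| ≤ C ^ Fintype.card κ * ∏ q, (w 0 (z q) * w 1 (z q)) := by
  have hz' : ∀ q, z q ∈ S := fun q => hz q (Set.mem_univ q)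
  have hprod : ∏ l, (w (ρ (l, 0)).2 (z (ρ (l, 0)).1) * w (ρ (l, 1)).2 (z (ρ (l, 1)).1)) =
      ∏ q, (w 0 (z q) * w 1 (z q)) := by
    have h1 : ∀ f : κ × Fin 2 → ℝ, ∏ l, (f (l, 0) * f (l, 1)) = ∏ q, f q := by
      intro f
      simp only [Fintype.prod_prod_type, Fin.prod_univ_two]
    have h2 := h1 fun q => w q.2 (z q.1)
    rw [h1 fun q => w (ρ q).2 (z (ρ q).1), Equiv.prod_comp ρ fun q => w q.2 (z q.1), ← h2]
  rw [slotMonomial, Finset.abs_prod, ← hprod, ← Finset.card_univ, ← Finset.prod_const,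
    ← Finset.prod_mul_distrib]
  exact Finset.prod_le_prod (fun _ _ => abs_nonneg _) fun l _ =>
    h.bound _ (hz' _) _ (hz' _) _ _

lemma DominatedOn.integrableOn_slotMonomial (h : DominatedOn K S C w) (hK : IsDerivKernel K)
    (ρ : Equiv.Perm (κ × Fin 2)) :
    IntegrableOn (slotMonomial K ρ) (Set.univ.pi fun _ => S) := by
  refine Integrable.mono' (h.integrableOn_prod.const_mul (C ^ Fintype.card κ))
    (hK.contDiff_slotMonomial ρ).continuous.aestronglyMeasurable ?_
  filter_upwards [ae_restrict_mem (MeasurableSet.univ_pi fun _ => h.measurableSet)] with z hz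
  exact h.abs_slotMonomial_le ρ hz

end Pi

/-! ### Bounds for Pfaffians -/

section Bound

/-- Hadamard's inequality. -/
lemma abs_det_le_prod_norm {k : ℕ} (N : Matrix (Fin k) (Fin k) ℝ) :
    |N.det| ≤ ∏ i, ‖WithLp.toLp 2 (N i)‖ := by
  let b := EuclideanSpace.basisFun (Fin k) ℝ
  have : Fact (Module.finrank ℝ (EuclideanSpace ℝ (Fin k)) = k) := ⟨by simp⟩
  have h := (b.toBasis.orientation).abs_volumeForm_apply_le fun i => WithLp.toLp 2 (N i)
  rw [Orientation.volumeForm_robust _ b rfl, Module.Basis.det_apply] at h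
  have h2 : b.toBasis.toMatrix (fun i => WithLp.toLp 2 (N i)) = N.transpose := by
    ext i j
    simp [Module.Basis.toMatrix_apply, b]
  rwa [h2, Matrix.det_transpose] at h

lemma abs_det_le_of_abs_le {k : ℕ} {N : Matrix (Fin k) (Fin k) ℝ} {C : ℝ} (hC : 0 ≤ C)
    (hN : ∀ i j, |N i j| ≤ C) : |N.det| ≤ (C * √k) ^ k := by
  refine (abs_det_le_prod_norm N).trans ?_
  calc ∏ i, ‖WithLp.toLp 2 (N i)‖ ≤ ∏ _i : Fin k, C * √k := by
        refine Finset.prod_le_prod (fun _ _ => norm_nonneg _) fun i _ => ?_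
        rw [EuclideanSpace.norm_eq]
        refine Real.sqrt_le_iff.2 ⟨by positivity, ?_⟩
        calc ∑ j, ‖N i j‖ ^ 2 ≤ ∑ _j : Fin k, C ^ 2 := Finset.sum_le_sum fun j _ => by
              rw [Real.norm_eq_abs]; gcongr; exact hN i j
          _ = (C * √k) ^ 2 := by
              rw [mul_pow, Real.sq_sqrt (by positivity)]; simp [mul_comm]
    _ = (C * √k) ^ k := by simp

/-- Precomposing `σ` with a permutation `ρ` of the first members of the pairs changes the sign by
`sign ρ`. Summing over the `k!` choices of `ρ` assembles determinants. -/
lemma factorial_mul_sum_perm_eq {k : ℕ} (M : Matrix (Fin k × Fin 2) (Fin k × Fin 2) ℝ) :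
    (k ! : ℝ) * ∑ σ : Equiv.Perm (Fin k × Fin 2),
        ((Equiv.Perm.sign σ : ℤ) : ℝ) * ∏ l : Fin k, M (σ (l, 0)) (σ (l, 1)) =
      ∑ σ : Equiv.Perm (Fin k × Fin 2), ((Equiv.Perm.sign σ : ℤ) : ℝ) *
        (Matrix.of fun i j => M (σ (i, 0)) (σ (j, 1))).det := by
  have h : ∀ ρ : Equiv.Perm (Fin k), ∑ σ : Equiv.Perm (Fin k × Fin 2),
        ((Equiv.Perm.sign σ : ℤ) : ℝ) * ∏ l : Fin k, M (σ (l, 0)) (σ (l, 1)) =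
      ∑ σ : Equiv.Perm (Fin k × Fin 2), ((Equiv.Perm.sign σ : ℤ) : ℝ) *
        (((Equiv.Perm.sign ρ : ℤ) : ℝ) * ∏ l : Fin k, M (σ (ρ l, 0)) (σ (l, 1))) := by
    intro ρ
    let r : Equiv.Perm (Fin k × Fin 2) := Equiv.prodCongrLeft fun s => if s = 0 then ρ else 1
    have hr : Equiv.Perm.sign r = Equiv.Perm.sign ρ := by
      simp [r, Equiv.Perm.sign_prodCongrLeft]
    rw [← Equiv.sum_comp (Equiv.mulRight r)]
    refine Finset.sum_congr rfl fun σ _ => ?_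
    simp [hr, r, mul_assoc]
  have hcard : (k ! : ℝ) = ∑ _ρ : Equiv.Perm (Fin k), (1 : ℝ) := by
    simp [Fintype.card_perm]
  rw [hcard, Finset.sum_mul]
  simp only [one_mul]
  rw [Finset.sum_congr rfl fun ρ _ => h ρ, Finset.sum_comm]
  refine Finset.sum_congr rfl fun σ _ => ?_
  rw [← Finset.mul_sum, Matrix.det_apply']
  rfl

/-- Estimating monomial by monomial would give `(2k)! / (2^k k!) C^k`, which after division by `k!`
is only geometric. Determinants and Hadamard's inequality replace a factor of order `k^k` by
`k^{k/2}`; the number of determinants is controlled by `(2k)! ≤ 4^k k!²`. -/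
lemma abs_pfaffian_le_of_abs_le {k : ℕ} {M : Matrix (Fin k × Fin 2) (Fin k × Fin 2) ℝ} {C : ℝ}
    (hC : 0 ≤ C) (hM : ∀ p q, |M p q| ≤ C) : |pfaffian M| ≤ (2 * C * √k) ^ k := by
  have hsum : |∑ σ : Equiv.Perm (Fin k × Fin 2), ((Equiv.Perm.sign σ : ℤ) : ℝ) *
        (Matrix.of fun i j => M (σ (i, 0)) (σ (j, 1))).det| ≤ (2 * k)! * (C * √k) ^ k := by
    refine (Finset.abs_sum_le_sum_abs _ _).trans ?_
    calc _ ≤ ∑ _σ : Equiv.Perm (Fin k × Fin 2), (C * √k) ^ k := by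
          refine Finset.sum_le_sum fun σ _ => ?_
          have h1 : |((Equiv.Perm.sign σ : ℤ) : ℝ)| = 1 := by
            rcases Int.units_eq_one_or (Equiv.Perm.sign σ) with h | h <;> simp [h]
          rw [abs_mul, h1, one_mul]
          exact abs_det_le_of_abs_le hC fun i j => hM _ _
      _ = _ := by simp [Fintype.card_perm, mul_comm]
  have hk : (0 : ℝ) < k ! := by positivity
  rw [pfaffian, abs_mul, abs_of_pos (by positivity : (0 : ℝ) < 1 / (2 ^ k * (k ! : ℝ)))]
  have hch : ((2 * k)! : ℝ) ≤ 4 ^ k * (k ! * k !) := by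
    have h1 := Nat.choose_le_two_pow (2 * k) k
    have h2 := Nat.choose_mul_factorial_mul_factorial (by lia : k ≤ 2 * k)
    rw [show 2 * k - k = k by lia] at h2
    rw [pow_mul] at h1
    have h3 : (2 * k)! ≤ 4 ^ k * (k ! * k !) := by
      rw [← h2, mul_assoc]; exact Nat.mul_le_mul_right _ h1
    exact_mod_cast h3
  rw [← factorial_mul_sum_perm_eq, abs_mul, abs_of_pos hk] at hsum
  have h4 : (k ! : ℝ) * |∑ σ : Equiv.Perm (Fin k × Fin 2),
        ((Equiv.Perm.sign σ : ℤ) : ℝ) * ∏ l : Fin k, M (σ (l, 0)) (σ (l, 1))| ≤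
      k ! * (4 ^ k * k ! * (C * √k) ^ k) := by
    refine hsum.trans ?_
    calc _ ≤ 4 ^ k * (k ! * k !) * (C * √k) ^ k := by gcongr
      _ = _ := by ring
  rw [div_mul_eq_mul_div, one_mul, div_le_iff₀ (by positivity)]
  refine (le_of_mul_le_mul_left h4 hk).trans (le_of_eq ?_)
  rw [show (4 : ℝ) = 2 * 2 by norm_num]
  simp only [mul_pow]
  ring

lemma pfaffian_of_mul_mul {k : ℕ} (M : Matrix (Fin k × Fin 2) (Fin k × Fin 2) ℝ)
    (u : Fin k × Fin 2 → ℝ) :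
    pfaffian (Matrix.of fun p q => u p * u q * M p q) = (∏ p, u p) * pfaffian M := by
  simp only [pfaffian, Matrix.of_apply, Finset.mul_sum]
  refine Finset.sum_congr rfl fun σ _ => ?_
  have h1 : ∏ l, (u (σ (l, 0)) * u (σ (l, 1))) = ∏ p, u p := by
    rw [← Equiv.prod_comp σ u, Fintype.prod_prod_type]
    simp only [Fin.prod_univ_two]
  rw [Finset.prod_mul_distrib, h1]
  ring

variable {K : Kernel} {S : Set ℝ} {C : ℝ} {w : Fin 2 → ℝ → ℝ}

/-- Scaling rows and columns by the weights reduces to a matrix with entries bounded by `C`. -/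
lemma DominatedOn.abs_pfaffian_le (h : DominatedOn K S C w) {k : ℕ} {x : Fin k → ℝ}
    (hx : x ∈ Set.univ.pi fun _ => S) :
    |pfaffian (blockMatrix K x)| ≤ (2 * C * √k) ^ k * ∏ i, (w 0 (x i) * w 1 (x i)) := by
  let u : Fin k × Fin 2 → ℝ := fun p => w p.2 (x p.1)
  have hu : ∀ p, 0 < u p := fun p => h.pos _ _
  let M : Matrix (Fin k × Fin 2) (Fin k × Fin 2) ℝ :=
    Matrix.of fun p q => blockMatrix K x p q / (u p * u q)
  have hM : blockMatrix K x = Matrix.of fun p q => u p * u q * M p q := by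
    ext p q
    have := (hu p).ne'
    have := (hu q).ne'
    simp only [M, Matrix.of_apply]
    field_simp
  have hMC : ∀ p q, |M p q| ≤ C := by
    intro p q
    have h1 := h.bound _ (hx p.1 (Set.mem_univ _)) _ (hx q.1 (Set.mem_univ _)) p.2 q.2
    have h2 : 0 < u p * u q := mul_pos (hu p) (hu q)
    simp only [M, Matrix.of_apply, abs_div, abs_of_pos h2]
    rw [div_le_iff₀ h2]
    exact h1
  have hprod : ∏ p, u p = ∏ i, (w 0 (x i) * w 1 (x i)) := by
    simp only [u, Fintype.prod_prod_type, Fin.prod_univ_two]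
  have hnn : 0 ≤ ∏ p, u p := Finset.prod_nonneg fun p _ => (hu p).le
  rw [hM, pfaffian_of_mul_mul, abs_mul, abs_of_nonneg hnn, mul_comm, hprod]
  rw [hprod] at hnn
  exact mul_le_mul_of_nonneg_right (abs_pfaffian_le_of_abs_le h.nonneg hMC) hnn

lemma pfaffian_blockMatrix_eq (K : Kernel) {k : ℕ} (x : Fin k → ℝ) :
    pfaffian (blockMatrix K x) = 1 / (2 ^ k * (k ! : ℝ)) *
      ∑ σ : Equiv.Perm (Fin k × Fin 2), ((Equiv.Perm.sign σ : ℤ) : ℝ) * slotMonomial K σ x := rfl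

lemma DominatedOn.integrableOn_pfaffian (h : DominatedOn K S C w) (hK : IsDerivKernel K)
    (k : ℕ) : IntegrableOn (fun x : Fin k → ℝ => pfaffian (blockMatrix K x))
      (Set.univ.pi fun _ => S) := by
  simp only [pfaffian_blockMatrix_eq]
  exact (integrable_finsetSum _ fun σ _ =>
    (h.integrableOn_slotMonomial hK σ).const_mul _).const_mul _

lemma DominatedOn.abs_fredholmTerm_le (h : DominatedOn K S C w) (k : ℕ) :
    |fredholmTerm K S k| ≤
      (2 * C * √k) ^ k * (∫ x in S, w 0 x * w 1 x) ^ k / k ! := by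
  have h1 : |∫ x in Set.univ.pi (fun _ : Fin k => S), pfaffian (blockMatrix K x)| ≤
      (2 * C * √k) ^ k * (∫ x in S, w 0 x * w 1 x) ^ k := by
    have h2 : ∫ z in Set.univ.pi (fun _ : Fin k => S), (2 * C * √k) ^ k *
        ∏ q, (w 0 (z q) * w 1 (z q)) = (2 * C * √k) ^ k * (∫ x in S, w 0 x * w 1 x) ^ k := by
      rw [integral_const_mul, restrict_volume_pi,
        integral_fintype_prod_eq_pow (fun x => w 0 x * w 1 x), Fintype.card_fin]
    rw [← h2, ← Real.norm_eq_abs]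
    refine norm_integral_le_of_norm_le ((h.integrableOn_prod (κ := Fin k)).const_mul _) ?_
    filter_upwards [ae_restrict_mem (MeasurableSet.univ_pi fun _ => h.measurableSet)] with z hz
    exact h.abs_pfaffian_le hz
  rw [fredholmTerm, abs_mul, abs_of_pos (by positivity : (0 : ℝ) < 1 / k !), one_div_mul_eq_div]
  gcongr

lemma summable_pow_mul_sqrt_pow_div_factorial (R : ℝ) :
    Summable fun k : ℕ => R ^ k * √k ^ k / k ! := by
  have h1 : Summable fun k : ℕ => (1 / 4 : ℝ) ^ k :=
    summable_geometric_of_lt_one (by norm_num) (by norm_num)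
  have h2 := Real.summable_pow_div_factorial (4 * R ^ 2 * Real.exp 1)
  refine Summable.of_norm_bounded (h1.add h2) fun k => ?_
  have hk : (0 : ℝ) < k ! := by positivity
  have h3 : (k : ℝ) ^ k ≤ Real.exp 1 ^ k * k ! := by
    have := Real.pow_div_factorial_le_exp (k : ℝ) (by positivity) k
    rw [div_le_iff₀ hk] at this
    rwa [← Real.exp_nat_mul, mul_one]
  -- The term is at most `a * b ≤ a² + b²`. Squaring turns `√k ^ k` into `k ^ k ≤ e^k k!`, so both
  -- squares are summable.
  set a : ℝ := (1 / 2) ^ k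
  set b : ℝ := (2 * |R|) ^ k * √k ^ k / k ! with hb
  have hb0 : 0 ≤ b := by positivity
  have h4 : ‖R ^ k * √k ^ k / (k ! : ℝ)‖ = a * b := by
    have ha : a * 2 ^ k = 1 := by rw [← mul_pow]; norm_num
    rw [Real.norm_eq_abs, abs_div, abs_mul, abs_pow, abs_pow, abs_of_nonneg (Real.sqrt_nonneg _),
      abs_of_pos hk, hb, mul_pow]
    linear_combination (-(|R| ^ k * √k ^ k / (k ! : ℝ))) * ha
  have h5 : a ^ 2 = (1 / 4 : ℝ) ^ k := by
    rw [← pow_mul, mul_comm, pow_mul]; norm_num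
  have h6 : b ^ 2 ≤ (4 * R ^ 2 * Real.exp 1) ^ k / k ! := by
    have : b ^ 2 = (4 * R ^ 2) ^ k * k ^ k / (k ! * k !) := by
      rw [hb, div_pow, mul_pow, ← pow_mul, mul_comm k 2, pow_mul, ← pow_mul √k, mul_comm k 2,
        pow_mul, Real.sq_sqrt (by positivity), mul_pow 2, sq_abs, sq (k ! : ℝ)]
      norm_num
    rw [this, mul_pow _ (Real.exp 1), div_le_div_iff₀ (by positivity) hk]
    calc _ ≤ (4 * R ^ 2) ^ k * (Real.exp 1 ^ k * k !) * k ! := by gcongr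
      _ = _ := by ring
  rw [h4]
  nlinarith [sq_nonneg (a - b), sq_nonneg a, sq_nonneg b]

lemma DominatedOn.summable_pow_mul_abs_fredholmTerm (h : DominatedOn K S C w) {t : ℝ}
    (ht : 0 ≤ t) : Summable fun k : ℕ => t ^ k * |fredholmTerm K S k| := by
  refine Summable.of_nonneg_of_le (fun k => by positivity) (fun k => ?_)
    (summable_pow_mul_sqrt_pow_div_factorial (t * (2 * C) * ∫ x in S, w 0 x * w 1 x))
  calc _ ≤ t ^ k * ((2 * C * √k) ^ k * (∫ x in S, w 0 x * w 1 x) ^ k / k !) := by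
        gcongr; exact h.abs_fredholmTerm_le k
    _ = _ := by simp only [mul_pow]; ring

lemma DominatedOn.fredholmConverges (h : DominatedOn K S C w) (hK : IsDerivKernel K) :
    FredholmConverges K S :=
  ⟨h.integrableOn_pfaffian hK, Summable.of_abs (by
    simpa only [one_pow, one_mul] using h.summable_pow_mul_abs_fredholmTerm zero_le_one)⟩

end Bound

/-! ### The terms of the expansion of `Pf (J + B)` -/

section SignedSum

variable {κ ι : Type} [Fintype κ] [DecidableEq κ] [Fintype ι] [DecidableEq ι]

/-- `∑_ρ sign(ρ) ∫ ∏_l K(ρ(l, 0), ρ(l, 1))`. -/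
def signedSum (κ : Type) [Fintype κ] [DecidableEq κ] (K : Kernel) (S : Set ℝ) : ℝ :=
  ∑ ρ : Equiv.Perm (κ × Fin 2), ((Equiv.Perm.sign ρ : ℤ) : ℝ) *
    ∫ z in Set.univ.pi (fun _ : κ => S), slotMonomial K ρ z

lemma signedSum_congr (e : κ ≃ ι) (K : Kernel) (S : Set ℝ) :
    signedSum κ K S = signedSum ι K S := by
  refine Fintype.sum_equiv (Equiv.permCongr (e.prodCongr (Equiv.refl (Fin 2)))) _ _ fun ρ => ?_
  rw [Equiv.Perm.sign_permCongr, ← setIntegral_pi_comp_equiv e S]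
  congr 1
  refine integral_congr_ae (ae_of_all _ fun y => ?_)
  simp only [slotMonomial]
  rw [← Equiv.prod_comp e]
  simp [Equiv.permCongr_apply]

lemma signedSum_fin {K : Kernel} {S : Set ℝ} {C : ℝ} {w : Fin 2 → ℝ → ℝ}
    (h : DominatedOn K S C w) (hK : IsDerivKernel K) (n : ℕ) :
    signedSum (Fin n) K S = 2 ^ n * n ! * n ! * fredholmTerm K S n := by
  have hn : (n ! : ℝ) ≠ 0 := by positivity
  simp only [fredholmTerm, pfaffian_blockMatrix_eq]
  rw [integral_const_mul, integral_finsetSum _ fun σ _ =>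
    (h.integrableOn_slotMonomial hK σ).const_mul _]
  simp only [integral_const_mul]
  rw [signedSum]
  field_simp

end SignedSum

lemma exists_equiv_extending {B T V : Type} [Fintype T] [Fintype V] [Finite B]
    (h : Fintype.card T = Fintype.card V) {f : B → T} (hf : Function.Injective f) {g : B → V}
    (hg : Function.Injective g) : ∃ e : T ≃ V, ∀ b, e (f b) = g b := by
  classical
  let e₀ : T ≃ V := Fintype.equivOfCardEq h
  have hef : Function.Injective (e₀ ∘ f) := e₀.injective.comp hf
  let e₁ : {x // x ∈ Set.range (e₀ ∘ f)} ≃ {x // x ∈ Set.range g} :=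
    (Equiv.ofInjective _ hef).symm.trans (Equiv.ofInjective g hg)
  refine ⟨e₀.trans e₁.extendSubtype, fun b => ?_⟩
  have hb : e₀ (f b) ∈ Set.range (e₀ ∘ f) := ⟨b, rfl⟩
  rw [Equiv.trans_apply, Equiv.extendSubtype_apply_of_mem e₁ _ hb]
  have h2 : (⟨e₀ (f b), hb⟩ : {x // x ∈ Set.range (e₀ ∘ f)}) = Equiv.ofInjective _ hef b := rfl
  rw [Equiv.trans_apply, h2, Equiv.symm_apply_apply]
  rfl

/-! ### Contribution of given positions and variables of the `δ'` factors -/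

section Terms

variable {α β : Type} {k : ℕ}

lemma keep_injective : Function.Injective (keep (α := α) (β := β)) :=
  Function.LeftInverse.injective (g := collapse) collapse_keep

lemma compl_eq_map_keep [Fintype α] [Fintype β] {π : (α ⊕ β × Fin 2) ≃ Fin k}
    {D : Finset (Fin k)} (hD : ∀ l, l ∈ D ↔ ∃ b, l = π (Sum.inr (b, 1))) :
    Dᶜ = Finset.univ.map ⟨fun q => π (keep q), π.injective.comp keep_injective⟩ := by
  ext l
  obtain ⟨t, rfl⟩ := π.surjective l
  simp only [Finset.mem_compl, hD, Finset.mem_map, Finset.mem_univ, true_and,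
    Function.Embedding.coeFn_mk, EmbeddingLike.apply_eq_iff_eq]
  rcases t with a | ⟨b, s⟩
  · simp only [reduceCtorEq, exists_false, not_false_eq_true, true_iff]
    exact ⟨Sum.inl a, rfl⟩
  · have h01 : s = 0 ∨ s = 1 := by fin_cases s <;> simp
    rcases h01 with rfl | rfl
    · simp only [Sum.inr.injEq, Prod.mk.injEq, zero_ne_one, and_false, exists_false,
        not_false_eq_true, true_iff]
      exact ⟨Sum.inr b, rfl⟩
    · simp [keep]

/-- Each second slot in a regular factor brings a 2. Those of the variables in `β × Fin 2` are taken
by `δ'`, so only the variables in `α` count. -/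
lemma regularProd_assemble {B : DeltaKernel} {K : Kernel} [Fintype α] [Fintype β]
    (hB : ∀ x y s t, B.regular x y s t = 2 ^ (s : ℕ) * 2 ^ (t : ℕ) * K x y s t)
    {π : (α ⊕ β × Fin 2) ≃ Fin k} (τ : (α ⊕ β × Fin 2) ≃ Fin k)
    (ρ : Equiv.Perm ((α ⊕ β) × Fin 2)) {D : Finset (Fin k)}
    (hD : ∀ l, l ∈ D ↔ ∃ b, l = π (Sum.inr (b, 1))) :
    B.regularProd (assemble π τ ρ) D =
      fun x => 2 ^ Fintype.card α * slotMonomial K (slot τ ∘ ρ) x := by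
  ext1 x
  have h1 : ∀ g : (α ⊕ β) × Fin 2 → ℝ, ∏ l, (g (l, 0) * g (l, 1)) = ∏ q, g q := by
    intro g
    simp only [Fintype.prod_prod_type, Fin.prod_univ_two]
  have h2 : ∏ l, ((2 : ℝ) ^ ((slot τ (ρ (l, 0))).2 : ℕ) * 2 ^ ((slot τ (ρ (l, 1))).2 : ℕ)) =
      2 ^ Fintype.card α := by
    rw [h1 fun q => (2 : ℝ) ^ ((slot τ (ρ q)).2 : ℕ),
      Equiv.prod_comp ρ fun q => (2 : ℝ) ^ ((slot τ q).2 : ℕ), Fintype.prod_prod_type,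
      Fintype.prod_sum_type]
    simp [slot]
  rw [DeltaKernel.regularProd, compl_eq_map_keep hD, Finset.prod_map, slotMonomial, ← h2,
    ← Finset.prod_mul_distrib]
  refine Finset.prod_congr rfl fun l _ => ?_
  simp only [Function.Embedding.coeFn_mk, assemble_keep, blockMatrix, Matrix.of_apply, hB,
    Function.comp_apply]

/-- The list does not depend on `ρ`, so the remaining variables are the same throughout the sum over
`ρ`. Its order is that of the positions in `D`. -/
lemma exists_deltaPairs_assemble_eq [Finite β] {π : (α ⊕ β × Fin 2) ≃ Fin k}
    (τ : (α ⊕ β × Fin 2) ≃ Fin k) {D : Finset (Fin k)}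
    (hD : ∀ l, l ∈ D ↔ ∃ b, l = π (Sum.inr (b, 1))) :
    ∃ L : List β, L.Nodup ∧ (∀ b, b ∈ L) ∧ ∀ ρ : Equiv.Perm ((α ⊕ β) × Fin 2),
      deltaPairs (assemble π τ ρ) D = L.map (deltaPair τ) := by
  let j : β → Fin k := fun b => π (Sum.inr (b, 1))
  have hj : Function.Injective j := fun b b' h => by simpa [j] using h
  have hrange : (List.finRange k).filter (fun l => l ∈ D) ∈ Set.range (List.map j) := by
    rw [Set.range_list_map]
    intro l hl
    have hl : l ∈ D := by simpa using hl
    obtain ⟨b, rfl⟩ := (hD l).1 hl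
    exact ⟨b, rfl⟩
  obtain ⟨L, hL⟩ := hrange
  refine ⟨L, ?_, fun b => ?_, fun ρ => ?_⟩
  · refine List.Nodup.of_map j ?_
    rw [hL]
    exact (List.nodup_finRange k).filter _
  · rw [← List.mem_map_of_injective hj, hL]
    simp [hD, j]
  · rw [deltaPairs, ← hL, List.map_map]
    refine List.map_congr_left fun b _ => ?_
    simp [j, assemble_inr_one, deltaPair]

variable [Fintype α] [DecidableEq α] [Fintype β] [DecidableEq β]
  {B : DeltaKernel} {K : Kernel} {S : Set ℝ} {C : ℝ} {w : Fin 2 → ℝ → ℝ}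

lemma integrableOn_deltaPrimeIntegrand_assemble (h : DominatedOn K S C w)
    (hK : IsDerivKernel K)
    (hB : ∀ x y s t, B.regular x y s t = 2 ^ (s : ℕ) * 2 ^ (t : ℕ) * K x y s t)
    {π : (α ⊕ β × Fin 2) ≃ Fin k} (τ : (α ⊕ β × Fin 2) ≃ Fin k)
    (ρ : Equiv.Perm ((α ⊕ β) × Fin 2)) {D : Finset (Fin k)}
    (hD : ∀ l, l ∈ D ↔ ∃ b, l = π (Sum.inr (b, 1))) :
    IntegrableOn (deltaPrimeIntegrand (deltaPairs (assemble π τ ρ) D)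
      (B.regularProd (assemble π τ ρ) D)) (Set.univ.pi fun _ => S) := by
  obtain ⟨L, hL, hL', hP⟩ := exists_deltaPairs_assemble_eq τ hD
  rw [hP, regularProd_assemble hB τ ρ hD,
    funext (deltaPrimeIntegrand_slotMonomial hK τ ρ (2 ^ Fintype.card α) hL hL')]
  refine (integrable_finsetSum _ fun U _ => ?_).const_mul _
  exact (integrableOn_pi_comp_equiv (keepEquiv τ L hL')
    (h.integrableOn_slotMonomial hK _)).const_mul _

lemma deltaPrimeIntegral_assemble (h : DominatedOn K S C w)
    (hK : IsDerivKernel K)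
    (hB : ∀ x y s t, B.regular x y s t = 2 ^ (s : ℕ) * 2 ^ (t : ℕ) * K x y s t)
    {π : (α ⊕ β × Fin 2) ≃ Fin k} (τ : (α ⊕ β × Fin 2) ≃ Fin k)
    (ρ : Equiv.Perm ((α ⊕ β) × Fin 2)) {D : Finset (Fin k)}
    (hD : ∀ l, l ∈ D ↔ ∃ b, l = π (Sum.inr (b, 1))) :
    deltaPrimeIntegral S (deltaPairs (assemble π τ ρ) D) (B.regularProd (assemble π τ ρ) D) =
      2 ^ Fintype.card α * ∑ U : Finset β, (-1) ^ U.card *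
        ∫ z in Set.univ.pi (fun _ => S), slotMonomial K (flip α U * ρ) z := by
  obtain ⟨L, hL, hL', hP⟩ := exists_deltaPairs_assemble_eq τ hD
  rw [hP, regularProd_assemble hB τ ρ hD, deltaPrimeIntegral,
    funext (deltaPrimeIntegrand_slotMonomial hK τ ρ (2 ^ Fintype.card α) hL hL'),
    integral_const_mul, integral_finsetSum _ fun U _ =>
      (integrableOn_pi_comp_equiv (keepEquiv τ L hL')
        (h.integrableOn_slotMonomial hK _)).const_mul _]
  congr 1
  refine Finset.sum_congr rfl fun U _ => ?_
  rw [integral_const_mul, setIntegral_pi_comp_equiv (keepEquiv τ L hL') S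
    (slotMonomial K (flip α U * ρ))]

/-- The signs `(-1)^|β|` of `assemble` and `(-1)^|U|` of the derivatives multiply to the sign of
`flip α U`. Hence, after the substitution `ρ ↦ flip α U * ρ`, each of the `2^|β|` sets `U`
contributes the same sum. -/
lemma sum_sign_assemble_mul_deltaPrimeIntegral (h : DominatedOn K S C w)
    (hK : IsDerivKernel K)
    (hB : ∀ x y s t, B.regular x y s t = 2 ^ (s : ℕ) * 2 ^ (t : ℕ) * K x y s t)
    {π : (α ⊕ β × Fin 2) ≃ Fin k} (τ : (α ⊕ β × Fin 2) ≃ Fin k) {D : Finset (Fin k)}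
    (hD : ∀ l, l ∈ D ↔ ∃ b, l = π (Sum.inr (b, 1))) :
    ∑ ρ : Equiv.Perm ((α ⊕ β) × Fin 2), ((Equiv.Perm.sign (assemble π τ ρ) : ℤ) : ℝ) *
      deltaPrimeIntegral S (deltaPairs (assemble π τ ρ) D) (B.regularProd (assemble π τ ρ) D) =
      2 ^ (Fintype.card α + Fintype.card β) * signedSum (α ⊕ β) K S := by
  have h1 : ∀ U : Finset β, ∑ ρ : Equiv.Perm ((α ⊕ β) × Fin 2),
      ((-1) ^ Fintype.card β * ((Equiv.Perm.sign ρ : ℤ) : ℝ)) * ((-1) ^ U.card *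
        ∫ z in Set.univ.pi (fun _ => S), slotMonomial K (flip α U * ρ) z) =
      signedSum (α ⊕ β) K S := by
    intro U
    rw [signedSum, ← Equiv.sum_comp (Equiv.mulLeft (flip α U)) fun ρ =>
      ((Equiv.Perm.sign ρ : ℤ) : ℝ) *
        ∫ z in Set.univ.pi (fun _ : α ⊕ β => S), slotMonomial K ρ z]
    refine Finset.sum_congr rfl fun ρ _ => ?_
    simp only [Equiv.coe_mulLeft, Equiv.Perm.sign_mul, sign_flip]
    simp only [Units.val_mul, Units.val_pow_eq_pow_val, Units.val_neg, Units.val_one, Int.cast_mul,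
      Int.cast_pow, Int.cast_neg, Int.cast_one]
    ring
  simp only [deltaPrimeIntegral_assemble h hK hB τ _ hD, sign_assemble]
  simp only [Units.val_mul, Units.val_pow_eq_pow_val, Units.val_neg, Units.val_one, Int.cast_mul,
    Int.cast_pow, Int.cast_neg, Int.cast_one]
  have h2 : ∀ ρ : Equiv.Perm ((α ⊕ β) × Fin 2),
      ((-1) ^ Fintype.card β * ((Equiv.Perm.sign ρ : ℤ) : ℝ)) *
        (2 ^ Fintype.card α * ∑ U : Finset β, (-1) ^ U.card *
          ∫ z in Set.univ.pi (fun _ => S), slotMonomial K (flip α U * ρ) z) =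
      2 ^ Fintype.card α * ∑ U : Finset β,
        ((-1) ^ Fintype.card β * ((Equiv.Perm.sign ρ : ℤ) : ℝ)) * ((-1) ^ U.card *
          ∫ z in Set.univ.pi (fun _ => S), slotMonomial K (flip α U * ρ) z) := by
    intro ρ
    rw [← Finset.mul_sum]
    ring
  rw [Finset.sum_congr rfl fun ρ _ => h2 ρ, ← Finset.mul_sum, Finset.sum_comm,
    Finset.sum_congr rfl fun U _ => h1 U]
  simp [pow_add, mul_assoc]

end Terms

/-! ### Counting the positions and variables of the `δ'` factors -/

section Count

variable {k : ℕ}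

/-- The variables of the `δ'` factors, for the positions `δ` of these. -/
def deltaVars {m : ℕ} (δ : Fin m → Fin k) (σ : Equiv.Perm (Fin k × Fin 2)) :
    Fin m × Fin 2 → Fin k :=
  fun q => (σ (δ q.1, q.2)).1

lemma apply_eq_of_admissible {m : ℕ} {δ : Fin m → Fin k} {D : Finset (Fin k)}
    (hδ : ∀ b, δ b ∈ D) {σ : Equiv.Perm (Fin k × Fin 2)} (hσ : Admissible σ D) (b : Fin m)
    (s : Fin 2) : σ (δ b, s) = (deltaVars δ σ (b, s), 1) := by
  have h := hσ (δ b) (hδ b)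
  refine Prod.ext rfl ?_
  have h01 : s = 0 ∨ s = 1 := by fin_cases s <;> simp
  rcases h01 with rfl | rfl
  · exact h.1
  · exact h.2

lemma deltaVars_injective {m : ℕ} {δ : Fin m → Fin k} {D : Finset (Fin k)}
    (hδ : ∀ b, δ b ∈ D) (hinj : Function.Injective δ) {σ : Equiv.Perm (Fin k × Fin 2)}
    (hσ : Admissible σ D) : Function.Injective (deltaVars δ σ) := by
  rintro ⟨b, s⟩ ⟨b', s'⟩ h
  have h1 : σ (δ b, s) = σ (δ b', s') := by
    rw [apply_eq_of_admissible hδ hσ, apply_eq_of_admissible hδ hσ, h]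
  have h2 := σ.injective h1
  simp only [Prod.mk.injEq] at h2
  exact Prod.ext (hinj h2.1) h2.2

/-- A choice of labels for given positions and variables of the `δ'` factors. -/
lemma exists_labels {p m : ℕ} (hk : p + 2 * m = k) {D : Finset (Fin k)} {δ : Fin m → Fin k}
    (hinj : Function.Injective δ) (hδ : ∀ l, l ∈ D ↔ ∃ b, l = δ b)
    {e : Fin m × Fin 2 → Fin k} (he : Function.Injective e) :
    ∃ π τ : (Fin p ⊕ Fin m × Fin 2) ≃ Fin k,
      (∀ l, l ∈ D ↔ ∃ b, l = π (Sum.inr (b, 1))) ∧ ∀ σ : Equiv.Perm (Fin k × Fin 2),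
        Admissible σ D ∧ deltaVars δ σ = e ↔ ∃ ρ, assemble π τ ρ = σ := by
  have hcard : Fintype.card (Fin p ⊕ Fin m × Fin 2) = Fintype.card (Fin k) := by
    simp; lia
  obtain ⟨π, hπ⟩ := exists_equiv_extending hcard
    (f := fun b : Fin m => (Sum.inr (b, 1) : Fin p ⊕ Fin m × Fin 2))
    (fun b b' h => by simpa using h) hinj
  obtain ⟨τ, hτ⟩ := exists_equiv_extending hcard
    (f := fun q : Fin m × Fin 2 => (Sum.inr q : Fin p ⊕ Fin m × Fin 2))
    Sum.inr_injective he
  have hδD : ∀ b, δ b ∈ D := fun b => (hδ _).2 ⟨b, rfl⟩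
  refine ⟨π, τ, fun l => by simp only [hδ, hπ], fun σ => ⟨?_, ?_⟩⟩
  · rintro ⟨hσ, rfl⟩
    refine exists_assemble_eq π τ σ fun b s => ?_
    rw [hπ, hτ, apply_eq_of_admissible hδD hσ]
  · rintro ⟨ρ, rfl⟩
    constructor
    · intro l hl
      obtain ⟨b, rfl⟩ := (hδ l).1 hl
      simp only [← hπ, assemble_inr_one, and_self]
    · ext1 ⟨b, s⟩
      simp only [deltaVars, ← hπ, assemble_inr_one, hτ]

lemma exists_enumeration (D : Finset (Fin k)) :
    ∃ δ : Fin D.card → Fin k, Function.Injective δ ∧ ∀ l, l ∈ D ↔ ∃ b, l = δ b := by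
  refine ⟨fun b => (D.equivFin.symm b : Fin k), fun b b' h => ?_, fun l => ⟨fun hl => ?_, ?_⟩⟩
  · exact D.equivFin.symm.injective (Subtype.ext h)
  · exact ⟨D.equivFin ⟨l, hl⟩, by simp⟩
  · rintro ⟨b, rfl⟩
    exact (D.equivFin.symm b).2

lemma two_mul_le_of_injective {m : ℕ} {e : Fin m × Fin 2 → Fin k} (he : Function.Injective e) :
    2 * m ≤ k := by
  have := Fintype.card_le_of_injective e he
  simp at this
  lia

variable {B : DeltaKernel} {K : Kernel} {S : Set ℝ} {C : ℝ} {w : Fin 2 → ℝ → ℝ}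

lemma integrableOn_deltaPrimeIntegrand (h : DominatedOn K S C w) (hK : IsDerivKernel K)
    (hB : ∀ x y s t, B.regular x y s t = 2 ^ (s : ℕ) * 2 ^ (t : ℕ) * K x y s t)
    {σ : Equiv.Perm (Fin k × Fin 2)} {D : Finset (Fin k)} (hσ : Admissible σ D) :
    IntegrableOn (deltaPrimeIntegrand (deltaPairs σ D) (B.regularProd σ D))
      (Set.univ.pi fun _ => S) := by
  obtain ⟨δ, hinj, hδ⟩ := exists_enumeration D
  have he := deltaVars_injective (fun b => (hδ _).2 ⟨b, rfl⟩) hinj hσ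
  have hk := two_mul_le_of_injective he
  obtain ⟨π, τ, hD, hτ⟩ := exists_labels (p := k - 2 * D.card) (by lia) hinj hδ he
  obtain ⟨ρ, rfl⟩ := (hτ σ).1 ⟨hσ, rfl⟩
  exact integrableOn_deltaPrimeIntegrand_assemble h hK hB τ ρ hD

/-- The permutations are grouped by the ordered variables of their `δ'` factors, that is, by an
injective map `Fin m × Fin 2 → Fin k`. Each group is the image of `assemble` for suitable labels and
contributes the same amount. -/
lemma sum_admissible_sign_mul_deltaPrimeIntegral (h : DominatedOn K S C w)
    (hK : IsDerivKernel K)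
    (hB : ∀ x y s t, B.regular x y s t = 2 ^ (s : ℕ) * 2 ^ (t : ℕ) * K x y s t)
    (D : Finset (Fin k)) :
    ∑ σ : Equiv.Perm (Fin k × Fin 2) with Admissible σ D, ((Equiv.Perm.sign σ : ℤ) : ℝ) *
        deltaPrimeIntegral S (deltaPairs σ D) (B.regularProd σ D) =
      k.descFactorial (2 * D.card) * (2 ^ (k - D.card) * signedSum (Fin (k - D.card)) K S) := by
  classical
  obtain ⟨δ, hinj, hδ⟩ := exists_enumeration D
  have hδD : ∀ b, δ b ∈ D := fun b => (hδ _).2 ⟨b, rfl⟩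
  let E : Finset (Fin D.card × Fin 2 → Fin k) := Finset.univ.filter Function.Injective
  have hE : E.card = k.descFactorial (2 * D.card) := by
    have h1 := Fintype.card_congr
      (Equiv.subtypeInjectiveEquivEmbedding (Fin D.card × Fin 2) (Fin k))
    rw [Fintype.card_embedding_eq, Fintype.card_subtype] at h1
    simpa [mul_comm] using h1
  rw [← Finset.sum_fiberwise_of_maps_to (t := E) (g := deltaVars δ)
    (fun σ hσ => by simpa [E] using deltaVars_injective hδD hinj (by simpa using hσ)),
    ← hE, ← nsmul_eq_mul]
  refine Finset.sum_eq_card_nsmul fun e he => ?_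
  have he : Function.Injective e := by simpa [E] using he
  have hk := two_mul_le_of_injective he
  obtain ⟨π, τ, hD, hτ⟩ := exists_labels (p := k - 2 * D.card) (by lia) hinj hδ he
  have hfilter : (Finset.univ.filter fun σ : Equiv.Perm (Fin k × Fin 2) =>
      Admissible σ D).filter (fun σ => deltaVars δ σ = e) =
        Finset.univ.map ⟨assemble π τ, assemble_injective π τ⟩ := by
    ext σ
    simp only [Finset.mem_filter, Finset.mem_univ, true_and, hτ, Finset.mem_map,
      Function.Embedding.coeFn_mk]
  rw [hfilter, Finset.sum_map]
  simp only [Function.Embedding.coeFn_mk]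
  rw [sum_sign_assemble_mul_deltaPrimeIntegral h hK hB τ hD]
  have hcard : Fintype.card (Fin (k - 2 * D.card)) + Fintype.card (Fin D.card) = k - D.card := by
    simp; lia
  rw [hcard, signedSum_congr (Fintype.equivFinOfCardEq (by
    rw [Fintype.card_sum, hcard])) K S]

/-- The sum over `σ` for fixed `D` depends on `D` only through its cardinality. -/
lemma pfaffianIntegral_eq (h : DominatedOn K S C w) (hK : IsDerivKernel K)
    (hB : ∀ x y s t, B.regular x y s t = 2 ^ (s : ℕ) * 2 ^ (t : ℕ) * K x y s t) (k : ℕ) :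
    B.pfaffianIntegral S k = 1 / (2 ^ k * (k ! : ℝ)) * ∑ m ∈ Finset.range (k + 1),
      (k.choose m : ℝ) * (B.coeff ^ m * (k.descFactorial (2 * m) *
        (2 ^ (k - m) * signedSum (Fin (k - m)) K S))) := by
  rw [DeltaKernel.pfaffianIntegral]
  congr 1
  have h1 := Finset.sum_powerset_apply_card (fun m => B.coeff ^ m * (k.descFactorial (2 * m) *
    (2 ^ (k - m) * signedSum (Fin (k - m)) K S))) (x := (Finset.univ : Finset (Fin k)))
  simp only [Finset.card_univ, Fintype.card_fin, nsmul_eq_mul, Finset.powerset_univ] at h1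
  rw [← h1]
  simp only [Finset.mul_sum, Finset.sum_filter]
  rw [Finset.sum_comm]
  refine Finset.sum_congr rfl fun D _ => ?_
  rw [← sum_admissible_sign_mul_deltaPrimeIntegral h hK hB D, Finset.mul_sum, Finset.sum_filter]
  refine Finset.sum_congr rfl fun σ _ => ?_
  split_ifs
  · ring
  · simp

/-- The terms of the expansion of `Pf (J + B)` in those of the expansion of `Pf (J + K)`. -/
lemma fredholmTerm_eq_sum_antidiagonal (h : DominatedOn K S C w) (hK : IsDerivKernel K)
    (hB : ∀ x y s t, B.regular x y s t = 2 ^ (s : ℕ) * 2 ^ (t : ℕ) * K x y s t) (k : ℕ) :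
    B.fredholmTerm S k = ∑ q ∈ Finset.HasAntidiagonal.antidiagonal k,
      B.coeff ^ q.2 * (2 ^ (q.1 - q.2) * q.1.choose q.2) * fredholmTerm K S q.1 := by
  rw [DeltaKernel.fredholmTerm, pfaffianIntegral_eq h hK hB, ← mul_assoc, Finset.mul_sum,
    ← Finset.Nat.sum_antidiagonal_swap, Finset.Nat.sum_antidiagonal_eq_sum_range_succ_mk]
  refine Finset.sum_congr rfl fun m hm => ?_
  have hm : m ≤ k := by simpa [Nat.lt_succ_iff] using hm
  simp only [Prod.swap]
  rw [signedSum_fin h hK]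
  -- Here `n = k - m`. If `2 * m > k`, there is no room for the `δ'` variables, and `n.choose m`
  -- vanishes as well because `m > n`.
  by_cases hmk : 2 * m ≤ k
  · obtain ⟨p, rfl⟩ := Nat.exists_eq_add_of_le hmk
    have h1 : 2 * m + p - m = m + p := by lia
    have h2 : m + p - m = p := by lia
    rw [h1, h2]
    have h3 : (((2 * m + p).choose m : ℕ) : ℝ) * (m ! * (m + p)!) = (2 * m + p)! := by
      have := Nat.choose_mul_factorial_mul_factorial (by lia : m ≤ 2 * m + p)
      rw [h1, mul_assoc] at this
      exact_mod_cast this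
    have h4 : ((m + p).choose m : ℝ) * (m ! * p !) = (m + p)! := by
      have := Nat.choose_mul_factorial_mul_factorial (by lia : m ≤ m + p)
      rw [h2, mul_assoc] at this
      exact_mod_cast this
    have h5 : (p ! : ℝ) * ((2 * m + p).descFactorial (2 * m) : ℕ) = (2 * m + p)! := by
      have := Nat.factorial_mul_descFactorial (by lia : 2 * m ≤ 2 * m + p)
      rw [show 2 * m + p - 2 * m = p by lia] at this
      exact_mod_cast this
    have hp : (p ! : ℝ) ≠ 0 := by positivity
    have hm0 : (m ! : ℝ) ≠ 0 := by positivity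
    have hmp : ((m + p)! : ℝ) ≠ 0 := by positivity
    have h3' : (((2 * m + p).choose m : ℕ) : ℝ) = (2 * m + p)! / (m ! * (m + p)!) := by
      rw [← h3]; field_simp
    have h4' : ((m + p).choose m : ℝ) = (m + p)! / (m ! * p !) := by
      rw [← h4]; field_simp
    have h5' : (((2 * m + p).descFactorial (2 * m) : ℕ) : ℝ) = (2 * m + p)! / p ! := by
      rw [← h5]; field_simp
    have hk0 : ((2 * m + p)! : ℝ) ≠ 0 := by positivity
    rw [h3', h4', h5']
    have h6 : (2 : ℝ) ^ (2 * m + p) = 2 ^ m * 2 ^ m * 2 ^ p := by ring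
    simp only [h6, pow_add]
    field_simp
  · rw [Nat.descFactorial_of_lt (by lia), Nat.choose_eq_zero_of_lt (by lia : k - m < m)]
    simp

end Count

/-! ### Summation of the expansion -/

section Summation

variable {B : DeltaKernel} {K : Kernel} {S : Set ℝ} {C : ℝ} {w : Fin 2 → ℝ → ℝ}

/-- The truncated exponent `n - m` is harmless, since the binomial coefficient vanishes for `m > n`.
-/
lemma hasSum_mul_choose (x y c : ℝ) (n : ℕ) :
    HasSum (fun m : ℕ => x ^ m * (y ^ (n - m) * n.choose m) * c) ((x + y) ^ n * c) := by
  refine HasSum.mul_right c ?_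
  rw [add_pow]
  simp only [mul_assoc]
  refine hasSum_sum_of_ne_finset_zero fun m hm => ?_
  rw [Nat.choose_eq_zero_of_lt (by simpa using hm)]
  simp

/-- Taking absolute values replaces `c` by 1, so the inner sums are `(1 + 2)^n |term_n|`. -/
lemma DominatedOn.summable_mul_choose (h : DominatedOn K S C w) {c : ℝ} (hc : |c| = 1) :
    Summable fun q : ℕ × ℕ =>
      c ^ q.2 * (2 ^ (q.1 - q.2) * q.1.choose q.2) * fredholmTerm K S q.1 := by
  have habs : ∀ q : ℕ × ℕ,
      |c ^ q.2 * (2 ^ (q.1 - q.2) * q.1.choose q.2) * fredholmTerm K S q.1| =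
        1 ^ q.2 * (2 ^ (q.1 - q.2) * q.1.choose q.2) * |fredholmTerm K S q.1| := by
    intro q
    rw [abs_mul, abs_mul, abs_pow, hc, abs_of_nonneg (by positivity :
      (0 : ℝ) ≤ 2 ^ (q.1 - q.2) * q.1.choose q.2)]
  refine Summable.of_abs ?_
  simp only [habs]
  refine (summable_prod_of_nonneg fun q => by simp only [Pi.zero_apply]; positivity).2
    ⟨fun n => (hasSum_mul_choose 1 2 |fredholmTerm K S n| n).summable, ?_⟩
  simp only [fun n => (hasSum_mul_choose 1 2 |fredholmTerm K S n| n).tsum_eq]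
  exact h.summable_pow_mul_abs_fredholmTerm (by norm_num)

/-- The same double series is summed in two ways: over `m` for fixed `n`, where the coefficients add
up to `(-1 + 2)^n = 1`, and over the antidiagonals `n + m = k`. -/
lemma hasSum_fredholmTerm_deltaKernel (h : DominatedOn K S C w) (hK : IsDerivKernel K)
    (hB : ∀ x y s t, B.regular x y s t = 2 ^ (s : ℕ) * 2 ^ (t : ℕ) * K x y s t)
    (hc : B.coeff = -1) : HasSum (fun k => B.fredholmTerm S k) (fredholmPfaffian K S) := by
  have hs := h.summable_mul_choose (c := -1) (by simp)
  have h1 := hs.tsum_prod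
  simp only [fun n => (hasSum_mul_choose (-1) 2 (fredholmTerm K S n) n).tsum_eq] at h1
  norm_num at h1
  have h2 := (Finset.HasAntidiagonal.sigmaAntidiagonalEquivProd.hasSum_iff).2 hs.hasSum
  rw [h1] at h2
  refine h2.sigma fun k => ?_
  rw [fredholmTerm_eq_sum_antidiagonal h hK hB, hc, ← Finset.sum_finset_coe]
  exact hasSum_fintype _

end Summation

/-! ### The kernels built from a smooth antisymmetric function -/

section Kernels

variable {A : ℝ → ℝ → ℝ}

lemma hasDerivAt_partialX (hA : ContDiff ℝ ∞ fun p : ℝ × ℝ => A p.1 p.2) (x y : ℝ) :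
    HasDerivAt (fun s => A s y) (partialX A x y) x := by
  have h : Differentiable ℝ fun s => (fun p : ℝ × ℝ => A p.1 p.2) (s, y) :=
    (hA.comp (contDiff_prodMk_left y)).differentiable (by simp)
  exact (h x).hasDerivAt

lemma hasDerivAt_partialY (hA : ContDiff ℝ ∞ fun p : ℝ × ℝ => A p.1 p.2) (x y : ℝ) :
    HasDerivAt (fun t => A x t) (partialY A x y) y := by
  have h : Differentiable ℝ fun t => (fun p : ℝ × ℝ => A p.1 p.2) (x, t) :=
    (hA.comp (contDiff_prodMk_right x)).differentiable (by simp)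
  exact (h y).hasDerivAt

lemma partialX_eq_fderiv (hA : ContDiff ℝ ∞ fun p : ℝ × ℝ => A p.1 p.2) (p : ℝ × ℝ) :
    partialX A p.1 p.2 = fderiv ℝ (fun p : ℝ × ℝ => A p.1 p.2) p (1, 0) := by
  refine (hasDerivAt_partialX hA p.1 p.2).unique ?_
  exact ((hA.differentiable (by simp)) p).hasFDerivAt.comp_hasDerivAt p.1
    ((hasDerivAt_id p.1).prodMk (hasDerivAt_const p.1 p.2))

lemma partialY_eq_fderiv (hA : ContDiff ℝ ∞ fun p : ℝ × ℝ => A p.1 p.2) (p : ℝ × ℝ) :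
    partialY A p.1 p.2 = fderiv ℝ (fun p : ℝ × ℝ => A p.1 p.2) p (0, 1) := by
  refine (hasDerivAt_partialY hA p.1 p.2).unique ?_
  exact ((hA.differentiable (by simp)) p).hasFDerivAt.comp_hasDerivAt p.2
    ((hasDerivAt_const p.2 p.1).prodMk (hasDerivAt_id p.2))

lemma contDiff_fderiv_apply_const {F : ℝ × ℝ → ℝ} (hF : ContDiff ℝ ∞ F) (v : ℝ × ℝ) :
    ContDiff ℝ ∞ fun p => fderiv ℝ F p v :=
  (hF.fderiv_right (m := ∞) (by simp)).clm_apply contDiff_const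

lemma contDiff_partialX (hA : ContDiff ℝ ∞ fun p : ℝ × ℝ => A p.1 p.2) :
    ContDiff ℝ ∞ fun p : ℝ × ℝ => partialX A p.1 p.2 := by
  simp only [partialX_eq_fderiv hA]
  exact contDiff_fderiv_apply_const hA _

lemma contDiff_partialY (hA : ContDiff ℝ ∞ fun p : ℝ × ℝ => A p.1 p.2) :
    ContDiff ℝ ∞ fun p : ℝ × ℝ => partialY A p.1 p.2 := by
  simp only [partialY_eq_fderiv hA]
  exact contDiff_fderiv_apply_const hA _

/-- Lets the entry `∂_x ∂_y A` serve as a derivative of both off-diagonal entries, as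
`IsDerivKernel` demands. -/
lemma partialY_partialX (hA : ContDiff ℝ ∞ fun p : ℝ × ℝ => A p.1 p.2) (x y : ℝ) :
    partialY (partialX A) x y = partialX (partialY A) x y := by
  have hd : DifferentiableAt ℝ (fderiv ℝ fun p : ℝ × ℝ => A p.1 p.2) (x, y) :=
    ((hA.fderiv_right (m := ∞) (by simp)).differentiable (by simp)) _
  have happ : ∀ v : ℝ × ℝ, HasFDerivAt (fun p => fderiv ℝ (fun p : ℝ × ℝ => A p.1 p.2) p v)
      ((fderiv ℝ (fderiv ℝ fun p : ℝ × ℝ => A p.1 p.2) (x, y)).flip v) (x, y) := fun v => by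
    simpa using hd.hasFDerivAt.clm_apply (hasFDerivAt_const v (x, y))
  have hsymm : IsSymmSndFDerivAt ℝ (fun p : ℝ × ℝ => A p.1 p.2) (x, y) :=
    hA.contDiffAt.isSymmSndFDerivAt (by
      rw [minSmoothness_of_isRCLikeNormedField]
      exact WithTop.coe_le_coe.2 le_top)
  rw [partialY_eq_fderiv (contDiff_partialX hA) (x, y),
    partialX_eq_fderiv (contDiff_partialY hA) (x, y)]
  simp only [partialX_eq_fderiv hA, partialY_eq_fderiv hA]
  rw [(happ _).fderiv, (happ _).fderiv]
  exact hsymm.eq _ _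

lemma isDerivKernel_kernelA (hA : ContDiff ℝ ∞ fun p : ℝ × ℝ => A p.1 p.2) :
    IsDerivKernel (kernelA A) where
  contDiff s t := by
    fin_cases s <;> fin_cases t
    · exact hA
    · exact (contDiff_partialY hA).neg
    · exact (contDiff_partialX hA).neg
    · exact contDiff_partialX (contDiff_partialY hA)
  hasDerivAt_left x y t := by
    fin_cases t
    · simpa [kernelA] using hasDerivAt_partialX hA x y
    · simpa [kernelA] using (hasDerivAt_partialX (contDiff_partialY hA) x y).fun_neg
  hasDerivAt_right x y s := by
    fin_cases s
    · simpa [kernelA] using hasDerivAt_partialY hA x y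
    · simpa [kernelA, partialY_partialX hA] using
        (hasDerivAt_partialY (contDiff_partialX hA) x y).fun_neg

lemma partialX_eq_neg_partialY (hA : ∀ x y, A x y = -A y x) (x y : ℝ) :
    partialX A x y = -partialY A y x := by
  rw [partialX, partialY, ← deriv.fun_neg]
  exact congrArg (fun f => deriv f x) (funext fun s => hA s y)

lemma exists_dominatedOn_kernelA (hA : ∀ x y, A x y = -A y x) {x₀ : ℝ}
    (h : ExpDecayOn (kernelA A) (Set.Ioi x₀)) :
    ∃ C w, DominatedOn (kernelA A) (Set.Ioi x₀) C w := by
  obtain ⟨C, a, b, hC, hb, hab, h⟩ := h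
  -- The first slot carries the weight `e^{-ax}`, the second `e^{bx}`; their product is integrable
  -- at infinity because `b < a`. The bound on the entry `21` follows from antisymmetry.
  refine ⟨C, ![fun x => Real.exp (-a * x), fun x => Real.exp (b * x)], measurableSet_Ioi, ?_,
    hC.le, ?_, ?_⟩
  · have h1 : ∀ x : ℝ, Real.exp (-a * x) * Real.exp (b * x) = Real.exp (-(a - b) * x) := by
      intro x
      rw [← Real.exp_add]
      congr 1
      ring
    simp only [Matrix.cons_val_zero, Matrix.cons_val_one, h1]
    exact integrableOn_exp_mul_Ioi (by linarith) x₀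
  · intro s x
    fin_cases s <;> exact Real.exp_pos _
  · intro x hx y hy s t
    obtain ⟨h11, h12, h22⟩ := h x hx y hy
    have h21 := (h y hy x hx).2.1
    fin_cases s <;> fin_cases t
    · simpa [← Real.exp_add, sub_eq_add_neg] using h11.le
    · simpa [← Real.exp_add] using h12.le
    · have : |kernelA A x y 1 0| = |kernelA A y x 0 1| := by
        simp [kernelA, partialX_eq_neg_partialY hA]
      simp only [Fin.mk_one, Fin.zero_eta, this]
      simpa [← Real.exp_add, add_comm] using h21.le
    · simpa [← Real.exp_add] using h22.le

lemma neg_kernelB_regular (A : ℝ → ℝ → ℝ) (x y : ℝ) (s t : Fin 2) :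
    (-kernelB A).regular x y s t = 2 ^ (s : ℕ) * 2 ^ (t : ℕ) * (-kernelA A) x y s t := by
  change -(kernelB A).regular x y s t = 2 ^ (s : ℕ) * 2 ^ (t : ℕ) * -kernelA A x y s t
  fin_cases s <;> fin_cases t <;> simp [kernelA, kernelB]
  left
  norm_num

lemma fredholmPfaffian_kernelA_eq_kernelB (hA : ContDiff ℝ ∞ fun p : ℝ × ℝ => A p.1 p.2)
    (hA' : ∀ x y, A x y = -A y x) {x₀ : ℝ} (h : ExpDecayOn (kernelA A) (Set.Ioi x₀)) :
    FredholmConverges (-kernelA A) (Set.Ioi x₀) ∧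
      (-kernelB A).FredholmConverges (Set.Ioi x₀) ∧
      fredholmPfaffian (-kernelA A) (Set.Ioi x₀) =
        (-kernelB A).fredholmPfaffian (Set.Ioi x₀) := by
  obtain ⟨C, w, hd⟩ := exists_dominatedOn_kernelA hA' h
  have hd := hd.neg
  have hK := (isDerivKernel_kernelA hA).neg
  have hB := neg_kernelB_regular A
  have hsum := hasSum_fredholmTerm_deltaKernel hd hK hB rfl
  exact ⟨hd.fredholmConverges hK,
    ⟨fun k σ D hσ => integrableOn_deltaPrimeIntegrand hd hK hB hσ, hsum.summable⟩,
    hsum.tsum_eq.symm⟩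

end Kernels

/-! ### Laplace integrals in two variables -/

section Laplace

variable {Ω : Type} [MeasurableSpace Ω] {μ : Measure Ω} {u v f g : Ω → ℂ}

/-- `∫ exp (-x u - y v) f dμ` -/
def laplaceIntegral (μ : Measure Ω) (u v f : Ω → ℂ) (x y : ℝ) : ℂ :=
  ∫ a, Complex.exp (-(x * u a + y * v a)) * f a ∂μ

/-- `f` is integrable against all exponentials `exp (R (‖u‖ + ‖v‖))`. -/
def RapidlyDecaying (μ : Measure Ω) (u v f : Ω → ℂ) : Prop :=
  ∀ R : ℝ, Integrable (fun a => Real.exp (R * (‖u a‖ + ‖v a‖)) • f a) μ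

lemma RapidlyDecaying.integrable (hf : RapidlyDecaying μ u v f) : Integrable f μ := by
  simpa using hf 0

lemma RapidlyDecaying.integrable_norm (hf : RapidlyDecaying μ u v f) (R : ℝ) :
    Integrable (fun a => Real.exp (R * (‖u a‖ + ‖v a‖)) * ‖f a‖) μ := by
  simpa only [norm_smul, Real.norm_eq_abs, Real.abs_exp] using (hf R).norm

lemma RapidlyDecaying.mul (hf : RapidlyDecaying μ u v f) (hg : AEStronglyMeasurable g μ)
    {c : ℝ} (hgc : ∀ a, ‖g a‖ ≤ Real.exp (c * (‖u a‖ + ‖v a‖))) :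
    RapidlyDecaying μ u v fun a => g a * f a := by
  intro R
  have h1 : AEStronglyMeasurable (fun a => Real.exp (R * (‖u a‖ + ‖v a‖)) • (g a * f a)) μ := by
    refine (hg.mul (hf R).aestronglyMeasurable).congr (Filter.Eventually.of_forall fun a => ?_)
    simp only [Pi.mul_apply, mul_smul_comm]
  refine (hf.integrable_norm (R + c)).mono' h1 (Filter.Eventually.of_forall fun a => ?_)
  rw [norm_smul, norm_mul, Real.norm_eq_abs, Real.abs_exp, add_mul, Real.exp_add, mul_assoc]
  gcongr
  exact hgc a

lemma RapidlyDecaying.mul_left (hf : RapidlyDecaying μ u v f) (hu : AEStronglyMeasurable u μ) :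
    RapidlyDecaying μ u v fun a => u a * f a :=
  hf.mul hu (c := 1) fun a => by
    have := Real.add_one_le_exp (1 * (‖u a‖ + ‖v a‖))
    linarith [norm_nonneg (v a)]

lemma RapidlyDecaying.mul_right (hf : RapidlyDecaying μ u v f) (hv : AEStronglyMeasurable v μ) :
    RapidlyDecaying μ u v fun a => v a * f a :=
  hf.mul hv (c := 1) fun a => by
    have := Real.add_one_le_exp (1 * (‖u a‖ + ‖v a‖))
    linarith [norm_nonneg (u a)]

lemma norm_exp_neg_le {R x y : ℝ} (hx : |x| ≤ R) (hy : |y| ≤ R) (z w : ℂ) :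
    ‖Complex.exp (-(x * z + y * w))‖ ≤ Real.exp (R * (‖z‖ + ‖w‖)) := by
  refine (Complex.norm_exp_le_exp_norm _).trans (Real.exp_le_exp.2 ?_)
  rw [norm_neg]
  refine (norm_add_le _ _).trans ?_
  rw [norm_mul, norm_mul, Complex.norm_real, Complex.norm_real, mul_add, Real.norm_eq_abs,
    Real.norm_eq_abs]
  gcongr

lemma RapidlyDecaying.integrable_exp_mul (hf : RapidlyDecaying μ u v f)
    (hu : AEStronglyMeasurable u μ) (hv : AEStronglyMeasurable v μ) (x y : ℝ) :
    Integrable (fun a => Complex.exp (-(x * u a + y * v a)) * f a) μ := by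
  have h : RapidlyDecaying μ u v fun a => Complex.exp (-(x * u a + y * v a)) * f a :=
    hf.mul (Complex.continuous_exp.comp_aestronglyMeasurable
      ((hu.const_mul _).add (hv.const_mul _)).neg) fun a =>
        norm_exp_neg_le (le_max_left |x| |y|) (le_max_right |x| |y|) _ _
  exact h.integrable

/-- The derivative of the exponent `-(x z + y w)`. -/
def exponentDeriv (z w : ℂ) : ℝ × ℝ →L[ℝ] ℂ :=
  -((ContinuousLinearMap.fst ℝ ℝ ℝ).smulRight z + (ContinuousLinearMap.snd ℝ ℝ ℝ).smulRight w)

lemma norm_exponentDeriv_le (z w : ℂ) : ‖exponentDeriv z w‖ ≤ ‖z‖ + ‖w‖ := by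
  refine ContinuousLinearMap.opNorm_le_bound _ (by positivity) fun p => ?_
  simp only [exponentDeriv, neg_apply, add_apply, ContinuousLinearMap.smulRight_apply,
    ContinuousLinearMap.coe_fst', ContinuousLinearMap.coe_snd', norm_neg]
  refine (norm_add_le _ _).trans ?_
  rw [norm_smul, norm_smul, add_mul, mul_comm ‖z‖, mul_comm ‖w‖]
  gcongr
  · exact norm_fst_le p
  · exact norm_snd_le p

lemma hasFDerivAt_exp_exponent (z w c : ℂ) (p : ℝ × ℝ) :
    HasFDerivAt (fun p : ℝ × ℝ => Complex.exp (-(p.1 * z + p.2 * w)) * c)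
      ((Complex.exp (-(p.1 * z + p.2 * w)) * c) • exponentDeriv z w) p := by
  have h1 : HasFDerivAt (fun p : ℝ × ℝ => -((p.1 : ℂ) * z + p.2 * w)) (exponentDeriv z w) p := by
    have h2 : (fun p : ℝ × ℝ => -((p.1 : ℂ) * z + p.2 * w)) = exponentDeriv z w := by
      ext p
      simp [exponentDeriv]
    rw [h2]
    exact (exponentDeriv z w).hasFDerivAt
  have h3 := h1.cexp.mul_const c
  refine h3.congr_fderiv ?_
  rw [smul_smul, mul_comm]

lemma hasFDerivAt_laplaceIntegral (hf : RapidlyDecaying μ u v f)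
    (hu : AEStronglyMeasurable u μ) (hv : AEStronglyMeasurable v μ) (p : ℝ × ℝ) :
    HasFDerivAt (fun p : ℝ × ℝ => laplaceIntegral μ u v f p.1 p.2)
      (-((ContinuousLinearMap.fst ℝ ℝ ℝ).smulRight
          (laplaceIntegral μ u v (fun a => u a * f a) p.1 p.2) +
        (ContinuousLinearMap.snd ℝ ℝ ℝ).smulRight
          (laplaceIntegral μ u v (fun a => v a * f a) p.1 p.2))) p := by
  have hiu := (hf.mul_left hu).integrable_exp_mul hu hv p.1 p.2
  have hiv := (hf.mul_right hv).integrable_exp_mul hu hv p.1 p.2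
  let Lu : ℂ →L[ℝ] ℝ × ℝ →L[ℝ] ℂ :=
    ContinuousLinearMap.smulRightL ℝ (ℝ × ℝ) ℂ (ContinuousLinearMap.fst ℝ ℝ ℝ)
  let Lv : ℂ →L[ℝ] ℝ × ℝ →L[ℝ] ℂ :=
    ContinuousLinearMap.smulRightL ℝ (ℝ × ℝ) ℂ (ContinuousLinearMap.snd ℝ ℝ ℝ)
  have hF' : ∀ a, (Complex.exp (-(p.1 * u a + p.2 * v a)) * f a) • exponentDeriv (u a) (v a) =
      -(Lu (Complex.exp (-(p.1 * u a + p.2 * v a)) * (u a * f a)) +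
        Lv (Complex.exp (-(p.1 * u a + p.2 * v a)) * (v a * f a))) := by
    intro a
    ext <;> simp [exponentDeriv, Lu, Lv] <;> ring
  have hint : ∫ a, (Complex.exp (-(p.1 * u a + p.2 * v a)) * f a) •
        exponentDeriv (u a) (v a) ∂μ =
      -((ContinuousLinearMap.fst ℝ ℝ ℝ).smulRight
          (laplaceIntegral μ u v (fun a => u a * f a) p.1 p.2) +
        (ContinuousLinearMap.snd ℝ ℝ ℝ).smulRight
          (laplaceIntegral μ u v (fun a => v a * f a) p.1 p.2)) := by
    simp only [hF']
    rw [integral_neg, integral_add (Lu.integrable_comp hiu) (Lv.integrable_comp hiv),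
      Lu.integral_comp_comm hiu, Lv.integral_comp_comm hiv]
    rfl
  rw [← hint]
  -- `R` bounds both coordinates on the unit ball around `p`; one more unit in the exponent absorbs
  -- the factor `‖u‖ + ‖v‖` from the derivative.
  set R : ℝ := max |p.1| |p.2| + 1
  refine hasFDerivAt_integral_of_dominated_of_fderiv_le
    (s := Metric.ball p 1)
    (bound := fun a => Real.exp ((R + 1) * (‖u a‖ + ‖v a‖)) * ‖f a‖)
    (F := fun q a => Complex.exp (-(q.1 * u a + q.2 * v a)) * f a)
    (F' := fun q a => (Complex.exp (-(q.1 * u a + q.2 * v a)) * f a) •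
      exponentDeriv (u a) (v a))
    (Metric.ball_mem_nhds p one_pos) ?_ ?_ ?_ ?_ ?_ ?_
  · exact Filter.Eventually.of_forall fun q =>
      (hf.integrable_exp_mul hu hv q.1 q.2).aestronglyMeasurable
  · exact hf.integrable_exp_mul hu hv p.1 p.2
  · simp only [hF']
    exact ((Lu.integrable_comp hiu).add (Lv.integrable_comp hiv)).neg.aestronglyMeasurable
  · refine Filter.Eventually.of_forall fun a q hq => ?_
    have hq1 : ‖q - p‖ < 1 := by rwa [← dist_eq_norm]
    have hx : |q.1| ≤ R := by
      have h1 := (norm_fst_le (q - p)).trans hq1.le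
      have h2 : |q.1| ≤ |p.1| + |q.1 - p.1| := by
        simpa using abs_add_le p.1 (q.1 - p.1)
      have h3 : |p.1| ≤ max |p.1| |p.2| := le_max_left _ _
      simp only [Prod.fst_sub, Real.norm_eq_abs] at h1
      simp only [R]
      linarith
    have hy : |q.2| ≤ R := by
      have h1 := (norm_snd_le (q - p)).trans hq1.le
      have h2 : |q.2| ≤ |p.2| + |q.2 - p.2| := by
        simpa using abs_add_le p.2 (q.2 - p.2)
      have h3 : |p.2| ≤ max |p.1| |p.2| := le_max_right _ _
      simp only [Prod.snd_sub, Real.norm_eq_abs] at h1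
      simp only [R]
      linarith
    have h4 : ‖exponentDeriv (u a) (v a)‖ ≤ Real.exp (‖u a‖ + ‖v a‖) := by
      have := Real.add_one_le_exp (‖u a‖ + ‖v a‖)
      linarith [norm_exponentDeriv_le (u a) (v a)]
    rw [norm_smul, norm_mul, add_mul, one_mul, Real.exp_add]
    calc _ ≤ Real.exp (R * (‖u a‖ + ‖v a‖)) * ‖f a‖ * Real.exp (‖u a‖ + ‖v a‖) := by
          gcongr
          exact norm_exp_neg_le hx hy _ _
      _ = _ := by ring
  · exact hf.integrable_norm (R + 1)
  · exact Filter.Eventually.of_forall fun a q _ => hasFDerivAt_exp_exponent _ _ _ _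

/-- The partial derivatives are again Laplace integrals, with densities `-u f` and `-v f` that still
decay rapidly. Induction on the order therefore runs over all `f`. -/
lemma contDiff_laplaceIntegral (hf : RapidlyDecaying μ u v f)
    (hu : AEStronglyMeasurable u μ) (hv : AEStronglyMeasurable v μ) :
    ContDiff ℝ ∞ fun p : ℝ × ℝ => laplaceIntegral μ u v f p.1 p.2 := by
  rw [contDiff_infty]
  intro n
  induction n generalizing f with
  | zero =>
    rw [Nat.cast_zero, contDiff_zero]
    exact continuous_iff_continuousAt.2 fun p =>
      (hasFDerivAt_laplaceIntegral hf hu hv p).continuousAt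
  | succ n ih =>
    rw [Nat.cast_succ, contDiff_succ_iff_hasFDerivAt]
    refine ⟨_, ?_, hasFDerivAt_laplaceIntegral hf hu hv⟩
    exact ((contDiff_const.smulRight (ih (hf.mul_left hu))).add
      (contDiff_const.smulRight (ih (hf.mul_right hv)))).neg

lemma hasDerivAt_laplaceIntegral_left (hf : RapidlyDecaying μ u v f)
    (hu : AEStronglyMeasurable u μ) (hv : AEStronglyMeasurable v μ) (x y : ℝ) :
    HasDerivAt (fun s => laplaceIntegral μ u v f s y)
      (-laplaceIntegral μ u v (fun a => u a * f a) x y) x := by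
  have h := (hasFDerivAt_laplaceIntegral hf hu hv (x, y)).comp_hasDerivAt x
    ((hasDerivAt_id x).prodMk (hasDerivAt_const x y))
  exact h.congr_deriv (by simp)

lemma hasDerivAt_laplaceIntegral_right (hf : RapidlyDecaying μ u v f)
    (hu : AEStronglyMeasurable u μ) (hv : AEStronglyMeasurable v μ) (x y : ℝ) :
    HasDerivAt (fun t => laplaceIntegral μ u v f x t)
      (-laplaceIntegral μ u v (fun a => v a * f a) x y) y := by
  have h := (hasFDerivAt_laplaceIntegral hf hu hv (x, y)).comp_hasDerivAt y
    ((hasDerivAt_const y x).prodMk (hasDerivAt_id y))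
  exact h.congr_deriv (by simp)

/-- In `x = x₀ + (x - x₀)`, the second part gives `e^{-(x - x₀)}` as `Re u ≥ 1`, and the first is
absorbed by the rapid decay; likewise for `y`. -/
lemma norm_laplaceIntegral_le (hf : RapidlyDecaying μ u v f) (hu : ∀ a, 1 ≤ (u a).re)
    (hv : ∀ a, 1 ≤ (v a).re) {x₀ x y : ℝ} (hx : x₀ ≤ x) (hy : x₀ ≤ y) :
    ‖laplaceIntegral μ u v f x y‖ ≤ Real.exp (2 * x₀ - x - y) *
      ∫ a, Real.exp (|x₀| * (‖u a‖ + ‖v a‖)) * ‖f a‖ ∂μ := by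
  rw [← integral_const_mul]
  refine norm_integral_le_of_norm_le ((hf.integrable_norm |x₀|).const_mul _)
    (Filter.Eventually.of_forall fun a => ?_)
  have key : ∀ (x : ℝ) (z : ℂ), x₀ ≤ x → 1 ≤ z.re → -(x * z.re) ≤ x₀ - x + |x₀| * ‖z‖ := by
    intro x z hx hz
    have h1 : -(x₀ * z.re) ≤ |x₀| * ‖z‖ := by
      calc _ ≤ |x₀ * z.re| := neg_le_abs _
        _ = |x₀| * |z.re| := abs_mul _ _
        _ ≤ _ := by gcongr; exact Complex.abs_re_le_norm z
    nlinarith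
  rw [norm_mul, Complex.norm_exp, ← mul_assoc, ← Real.exp_add]
  refine mul_le_mul_of_nonneg_right (Real.exp_le_exp.2 ?_) (norm_nonneg _)
  have h1 := key x (u a) hx (hu a)
  have h2 := key y (v a) hy (hv a)
  simp only [Complex.neg_re, Complex.add_re, Complex.re_ofReal_mul]
  linarith

end Laplace

/-! ### The GSE kernel -/

section GSE

/-- The point `1 + |t| e^{± iπ/3}` of the contour, with the sign of `t`. -/
def rayPoint (t : ℝ) : ℂ := ⟨1 + |t| / 2, √3 / 2 * t⟩

/-- The direction of the contour at `rayPoint t`. -/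
def rayDir (t : ℝ) : ℂ := ⟨t / |t| / 2, √3 / 2⟩

lemma exp_pi_div_three : Complex.exp ((Real.pi / 3 : ℝ) * Complex.I) = ⟨1 / 2, √3 / 2⟩ := by
  apply Complex.ext
  · rw [Complex.exp_ofReal_mul_I_re, Real.cos_pi_div_three]
  · rw [Complex.exp_ofReal_mul_I_im, Real.sin_pi_div_three]

lemma exp_neg_pi_div_three :
    Complex.exp (-((Real.pi / 3 : ℝ) : ℂ) * Complex.I) = ⟨1 / 2, -(√3 / 2)⟩ := by
  rw [← Complex.ofReal_neg]
  apply Complex.ext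
  · rw [Complex.exp_ofReal_mul_I_re, Real.cos_neg, Real.cos_pi_div_three]
  · rw [Complex.exp_ofReal_mul_I_im, Real.sin_neg, Real.sin_pi_div_three]

/-- The lower ray, reversed, is the part `t < 0` of one parametrization by `ℝ`. The value of
`rayDir` at `0`, where `t / |t|` is `0`, does not matter for the integral. -/
lemma rayIntegral_eq (f : ℂ → ℂ) (hf : Integrable fun t => f (rayPoint t) * rayDir t) :
    rayIntegral 1 (Real.pi / 3) f =
      1 / (2 * Real.pi * Complex.I) * ∫ t, f (rayPoint t) * rayDir t := by
  have h1 : ∫ t in Set.Ioi (0 : ℝ), f (1 + t * Complex.exp ((Real.pi / 3 : ℝ) * Complex.I)) *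
      Complex.exp ((Real.pi / 3 : ℝ) * Complex.I) =
      ∫ t in Set.Ioi (0 : ℝ), f (rayPoint t) * rayDir t := by
    refine setIntegral_congr_fun measurableSet_Ioi fun t ht => ?_
    have ht : (0 : ℝ) < t := ht
    have e1 : (1 : ℂ) + t * ⟨1 / 2, √3 / 2⟩ = rayPoint t := by
      apply Complex.ext <;> simp [rayPoint, abs_of_pos ht] <;> ring
    have e2 : (⟨1 / 2, √3 / 2⟩ : ℂ) = rayDir t := by
      apply Complex.ext <;> simp [rayDir, abs_of_pos ht, ht.ne']
    simp only [exp_pi_div_three]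
    rw [e1, e2]
  have h2 : ∫ t in Set.Ioi (0 : ℝ), f (1 + t * Complex.exp (-((Real.pi / 3 : ℝ) : ℂ) *
      Complex.I)) * Complex.exp (-((Real.pi / 3 : ℝ) : ℂ) * Complex.I) =
      -∫ t in Set.Iic (0 : ℝ), f (rayPoint t) * rayDir t := by
    rw [← neg_zero, ← integral_comp_neg_Ioi, neg_zero, ← integral_neg]
    refine setIntegral_congr_fun measurableSet_Ioi fun t ht => ?_
    have ht : (0 : ℝ) < t := ht
    have e1 : (1 : ℂ) + t * ⟨1 / 2, -(√3 / 2)⟩ = rayPoint (-t) := by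
      apply Complex.ext <;> simp [rayPoint, abs_of_pos ht] <;> ring
    have e2 : (⟨1 / 2, -(√3 / 2)⟩ : ℂ) = -rayDir (-t) := by
      apply Complex.ext <;> simp [rayDir, abs_of_pos ht, ht.ne', neg_div]
    simp only [exp_neg_pi_div_three]
    rw [e1, e2]
    ring
  have h3 : ((Real.pi : ℂ) / 3) = ((Real.pi / 3 : ℝ) : ℂ) := by push_cast; ring
  rw [rayIntegral, h1, h2, sub_neg_eq_add, add_comm,
    intervalIntegral.integral_Iic_add_Ioi hf.integrableOn hf.integrableOn]

lemma rayPoint_neg (t : ℝ) : rayPoint (-t) = (starRingEnd ℂ) (rayPoint t) := by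
  apply Complex.ext <;> simp [rayPoint]

lemma rayDir_neg (t : ℝ) : rayDir (-t) = -(starRingEnd ℂ) (rayDir t) := by
  apply Complex.ext <;> simp [rayDir, neg_div]

lemma one_le_re_rayPoint (t : ℝ) : 1 ≤ (rayPoint t).re := by
  simp only [rayPoint]; linarith [abs_nonneg t]

lemma continuous_rayPoint : Continuous rayPoint := by
  have : rayPoint = fun t : ℝ => ((1 + |t| / 2 : ℝ) : ℂ) + ((√3 / 2 * t : ℝ) : ℂ) * Complex.I := by
    ext1 t
    apply Complex.ext <;> simp [rayPoint]
  rw [this]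
  fun_prop

lemma measurable_rayDir : Measurable rayDir := by
  have : rayDir = fun t : ℝ => ((t / |t| / 2 : ℝ) : ℂ) + ((√3 / 2 : ℝ) : ℂ) * Complex.I := by
    ext1 t
    apply Complex.ext <;> simp [rayDir]
  rw [this]
  have h : Measurable fun t : ℝ => t / |t| / 2 :=
    (measurable_id.div continuous_abs.measurable).div_const 2
  exact (Complex.measurable_ofReal.comp h).add_const _

lemma norm_rayPoint_le (t : ℝ) : ‖rayPoint t‖ ≤ 1 + |t| := by
  have h3 : (√3 / 2) ^ 2 = 3 / 4 := by rw [div_pow, Real.sq_sqrt (by norm_num)]; norm_num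
  have h := sq_abs t
  refine abs_le_of_sq_le_sq' ?_ (by positivity) |>.2
  rw [Complex.sq_norm, Complex.normSq_apply]
  simp only [rayPoint]
  nlinarith [abs_nonneg t]

lemma norm_rayDir_le (t : ℝ) : ‖rayDir t‖ ≤ 1 := by
  have h3 : (√3 / 2) ^ 2 = 3 / 4 := by rw [div_pow, Real.sq_sqrt (by norm_num)]; norm_num
  have h : (t / |t|) ^ 2 ≤ 1 := by
    rw [div_pow, sq_abs]; exact div_self_le_one _
  refine abs_le_of_sq_le_sq' ?_ (by positivity) |>.2
  rw [Complex.sq_norm, Complex.normSq_apply]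
  simp only [rayDir]
  nlinarith

lemma re_rayPoint_pow_three_div (t : ℝ) :
    (rayPoint t ^ 3 / 3).re = 1 / 3 + |t| / 2 - t ^ 2 / 2 - |t| ^ 3 / 3 := by
  have h3 : √3 ^ 2 = 3 := Real.sq_sqrt (by norm_num)
  have h := sq_abs t
  have h1 : (rayPoint t ^ 3 / 3).re = (rayPoint t ^ 3).re / 3 := by
    rw [show (3 : ℂ) = ((3 : ℝ) : ℂ) by norm_num, Complex.div_ofReal_re]
  rw [h1, pow_succ, pow_two]
  simp only [Complex.mul_re, Complex.mul_im, rayPoint]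
  rw [← h]
  have h4 : √3 / 2 * t * (√3 / 2 * t) = 3 / 4 * |t| ^ 2 := by
    rw [h]; linear_combination (t ^ 2 / 4) * h3
  linear_combination (-(1 + |t| / 2)) * h4

/-- The density `e^{z³/3} dz` along the contour. -/
def rayWeight (t : ℝ) : ℂ := Complex.exp (rayPoint t ^ 3 / 3) * rayDir t

lemma measurable_rayWeight : Measurable rayWeight :=
  (Complex.continuous_exp.comp ((continuous_rayPoint.pow 3).div_const 3)).measurable.mul
    measurable_rayDir

lemma rayWeight_neg (t : ℝ) : rayWeight (-t) = -(starRingEnd ℂ) (rayWeight t) := by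
  rw [rayWeight, rayWeight, rayPoint_neg, rayDir_neg, map_mul, ← Complex.exp_conj,
    map_div₀, map_pow, map_ofNat]
  ring

lemma integrable_exp_smul_rayWeight (R : ℝ) :
    Integrable fun t => Real.exp (R * ‖rayPoint t‖) • rayWeight t := by
  have hmeas : AEStronglyMeasurable
      (fun t => Real.exp (R * ‖rayPoint t‖) • rayWeight t) volume :=
    ((Real.continuous_exp.comp (continuous_const.mul continuous_rayPoint.norm)).measurable.smul
      measurable_rayWeight).aestronglyMeasurable
  -- The exponent is at most `|R| + 1/3 + (|R| + 1/2)|t| - t²/2`, and `(|R| + 1/2)|t| ≤ t²/4 + (|R|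
  -- + 1/2)²` leaves the Gaussian `e^{-t²/4}`.
  refine Integrable.mono' ((integrable_exp_neg_mul_sq (b := 1 / 4) (by norm_num)).const_mul
    (Real.exp (|R| + 1 / 3 + (|R| + 1 / 2) ^ 2))) hmeas (Filter.Eventually.of_forall fun t => ?_)
  rw [norm_smul, rayWeight, norm_mul, Complex.norm_exp, Real.norm_eq_abs, Real.abs_exp,
    re_rayPoint_pow_three_div]
  calc _ ≤ Real.exp (|R| * (1 + |t|)) *
        (Real.exp (1 / 3 + |t| / 2 - t ^ 2 / 2 - |t| ^ 3 / 3) * 1) := by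
        gcongr
        · exact le_abs_self R
        · exact norm_rayPoint_le t
        · exact norm_rayDir_le t
    _ ≤ _ := by
        rw [mul_one, ← Real.exp_add, ← Real.exp_add]
        refine Real.exp_le_exp.2 ?_
        have h := sq_abs t
        have h3 : 0 ≤ |t| ^ 3 := by positivity
        nlinarith [sq_nonneg (|t| / 2 - (|R| + 1 / 2))]

/-- The function `(z - w) / (4 z w (z + w)) e^{z³/3 + w³/3}` along the contours. -/
def gseDensity (p : ℝ × ℝ) : ℂ :=
  (rayPoint p.1 - rayPoint p.2) /
    (4 * rayPoint p.1 * rayPoint p.2 * (rayPoint p.1 + rayPoint p.2)) *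
    (rayWeight p.1 * rayWeight p.2)

lemma continuous_rayPoint_fst : Continuous fun p : ℝ × ℝ => rayPoint p.1 :=
  continuous_rayPoint.comp continuous_fst

lemma continuous_rayPoint_snd : Continuous fun p : ℝ × ℝ => rayPoint p.2 :=
  continuous_rayPoint.comp continuous_snd

lemma one_le_norm_rayPoint (t : ℝ) : 1 ≤ ‖rayPoint t‖ :=
  (one_le_re_rayPoint t).trans (Complex.re_le_norm _)

lemma rayPoint_ne_zero (t : ℝ) : rayPoint t ≠ 0 :=
  norm_pos_iff.1 (one_pos.trans_le (one_le_norm_rayPoint t))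

lemma one_le_norm_rayPoint_add (s t : ℝ) : 1 ≤ ‖rayPoint s + rayPoint t‖ := by
  refine le_trans ?_ (Complex.re_le_norm _)
  rw [Complex.add_re]
  linarith [one_le_re_rayPoint s, one_le_re_rayPoint t]

lemma rayPoint_add_ne_zero (s t : ℝ) : rayPoint s + rayPoint t ≠ 0 :=
  norm_pos_iff.1 (one_pos.trans_le (one_le_norm_rayPoint_add s t))

lemma rapidlyDecaying_gseDensity : RapidlyDecaying volume (fun p : ℝ × ℝ => rayPoint p.1)
    (fun p => rayPoint p.2) gseDensity := by
  have h1 : RapidlyDecaying volume (fun p : ℝ × ℝ => rayPoint p.1) (fun p => rayPoint p.2)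
      fun p => rayWeight p.1 * rayWeight p.2 := by
    intro R
    refine ((integrable_exp_smul_rayWeight R).mul_prod (integrable_exp_smul_rayWeight R)).congr
      (Filter.Eventually.of_forall fun p => ?_)
    simp only [mul_add, Real.exp_add, Complex.real_smul, Complex.ofReal_mul]
    ring
  refine h1.mul (c := 1) ?_ fun p => ?_
  · refine Continuous.aestronglyMeasurable ?_
    refine (continuous_rayPoint_fst.sub continuous_rayPoint_snd).div
      (((continuous_const.mul continuous_rayPoint_fst).mul continuous_rayPoint_snd).mul
        (continuous_rayPoint_fst.add continuous_rayPoint_snd)) fun p => ?_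
    simp [rayPoint_ne_zero, rayPoint_add_ne_zero]
  · have hz := one_le_norm_rayPoint p.1
    have hw := one_le_norm_rayPoint p.2
    have hzw := one_le_norm_rayPoint_add p.1 p.2
    have hden : 1 ≤ ‖4 * rayPoint p.1 * rayPoint p.2 * (rayPoint p.1 + rayPoint p.2)‖ := by
      simp only [norm_mul, Complex.norm_ofNat]
      exact one_le_mul_of_one_le_of_one_le (one_le_mul_of_one_le_of_one_le
        (one_le_mul_of_one_le_of_one_le (by norm_num) hz) hw) hzw
    rw [norm_div]
    refine (div_le_self (norm_nonneg _) hden).trans ((norm_sub_le _ _).trans ?_)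
    rw [one_mul]
    linarith [Real.add_one_le_exp (‖rayPoint p.1‖ + ‖rayPoint p.2‖)]

/-- Laplace integrals along the two contours. -/
def gseLaplace (f : ℝ × ℝ → ℂ) (x y : ℝ) : ℂ :=
  laplaceIntegral volume (fun p : ℝ × ℝ => rayPoint p.1) (fun p => rayPoint p.2) f x y

/-- The factor `1 / (2 i π)²`. -/
def gseConst : ℝ := -(1 / (4 * Real.pi ^ 2))

lemma rayDir_ne_zero (t : ℝ) : rayDir t ≠ 0 := by
  intro h
  have := congrArg Complex.im h
  simp [rayDir] at this

/-- Fubini's theorem along the two contours, with `1 / (2iπ)² = -1 / (4π²)`. -/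
lemma airyDoubleIntegral_eq (g : ℂ → ℂ → ℂ) (f : ℝ × ℝ → ℂ)
    (hf : RapidlyDecaying volume (fun p : ℝ × ℝ => rayPoint p.1) (fun p => rayPoint p.2) f)
    (hg : ∀ p : ℝ × ℝ, f p = g (rayPoint p.1) (rayPoint p.2) * (rayWeight p.1 * rayWeight p.2))
    (x y : ℝ) : airyDoubleIntegral g x y = gseConst * gseLaplace f x y := by
  have hi := hf.integrable_exp_mul continuous_rayPoint_fst.aestronglyMeasurable
    continuous_rayPoint_snd.aestronglyMeasurable x y
  have hpt : ∀ t s, (g (rayPoint t) (rayPoint s) *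
      Complex.exp (rayPoint t ^ 3 / 3 + rayPoint s ^ 3 / 3 - x * rayPoint t - y * rayPoint s)) *
        rayDir s * rayDir t =
      Complex.exp (-(x * rayPoint t + y * rayPoint s)) * f (t, s) := by
    intro t s
    have : rayPoint t ^ 3 / 3 + rayPoint s ^ 3 / 3 - x * rayPoint t - y * rayPoint s =
      -(x * rayPoint t + y * rayPoint s) + rayPoint t ^ 3 / 3 + rayPoint s ^ 3 / 3 := by ring
    rw [hg, this, Complex.exp_add, Complex.exp_add, rayWeight, rayWeight]
    ring
  -- Joint integrability gives integrability of the inner integrand for almost every `t` only, which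
  -- suffices for the outer integral. The factor `rayDir t` can be divided out because it never
  -- vanishes.
  have hinner : ∀ᵐ t : ℝ, 1 / (2 * Real.pi * Complex.I) *
        ∫ s, Complex.exp (-(x * rayPoint t + y * rayPoint s)) * f (t, s) =
      (rayIntegral 1 (Real.pi / 3) fun w => g (rayPoint t) w *
        Complex.exp (rayPoint t ^ 3 / 3 + w ^ 3 / 3 - x * rayPoint t - y * w)) * rayDir t := by
    filter_upwards [hi.prod_right_ae] with t ht
    have h1 : Integrable fun s => (g (rayPoint t) (rayPoint s) *
        Complex.exp (rayPoint t ^ 3 / 3 + rayPoint s ^ 3 / 3 - x * rayPoint t -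
          y * rayPoint s)) * rayDir s := by
      have h2 := ht.mul_const (rayDir t)⁻¹
      refine h2.congr (Filter.Eventually.of_forall fun s => ?_)
      change Complex.exp (-(x * rayPoint t + y * rayPoint s)) * f (t, s) * (rayDir t)⁻¹ = _
      rw [← hpt, mul_inv_cancel_right₀ (rayDir_ne_zero t)]
    have h3 := rayIntegral_eq (fun w => g (rayPoint t) w *
        Complex.exp (rayPoint t ^ 3 / 3 + w ^ 3 / 3 - x * rayPoint t - y * w)) h1
    rw [h3]
    simp only [← hpt]
    rw [integral_mul_const, mul_assoc (1 / (2 * (Real.pi : ℂ) * Complex.I))]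
  have hi2 : Integrable fun t => (rayIntegral 1 (Real.pi / 3) fun w => g (rayPoint t) w *
      Complex.exp (rayPoint t ^ 3 / 3 + w ^ 3 / 3 - x * rayPoint t - y * w)) * rayDir t :=
    ((Integrable.integral_prod_left hi).const_mul _).congr hinner
  have h4 := rayIntegral_eq (fun z => rayIntegral 1 (Real.pi / 3) fun w => g z w *
    Complex.exp (z ^ 3 / 3 + w ^ 3 / 3 - x * z - y * w)) hi2
  have h5 : gseLaplace f x y =
      ∫ t, ∫ s, Complex.exp (-(x * rayPoint t + y * rayPoint s)) * f (t, s) :=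
    integral_prod _ hi
  rw [airyDoubleIntegral, h4, ← integral_congr_ae hinner, integral_const_mul, h5, ← mul_assoc]
  congr 1
  have hpi : (Real.pi : ℂ) ≠ 0 := by exact_mod_cast Real.pi_ne_zero
  simp only [gseConst]
  push_cast
  field_simp
  rw [Complex.I_sq]
  ring

lemma rapidlyDecaying_fst {f : ℝ × ℝ → ℂ}
    (hf : RapidlyDecaying volume (fun p : ℝ × ℝ => rayPoint p.1) (fun p => rayPoint p.2) f) :
    RapidlyDecaying volume (fun p : ℝ × ℝ => rayPoint p.1) (fun p => rayPoint p.2)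
      fun p => rayPoint p.1 * f p :=
  hf.mul_left continuous_rayPoint_fst.aestronglyMeasurable

lemma rapidlyDecaying_snd {f : ℝ × ℝ → ℂ}
    (hf : RapidlyDecaying volume (fun p : ℝ × ℝ => rayPoint p.1) (fun p => rayPoint p.2) f) :
    RapidlyDecaying volume (fun p : ℝ × ℝ => rayPoint p.1) (fun p => rayPoint p.2)
      fun p => rayPoint p.2 * f p :=
  hf.mul_right continuous_rayPoint_snd.aestronglyMeasurable

lemma gse11_eq (x y : ℝ) : gse11 x y = gseConst * gseLaplace gseDensity x y :=
  airyDoubleIntegral_eq _ _ rapidlyDecaying_gseDensity (fun _ => rfl) x y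

lemma gse12_eq (x y : ℝ) :
    gse12 x y = gseConst * gseLaplace (fun p => rayPoint p.2 * gseDensity p) x y := by
  refine airyDoubleIntegral_eq _ _ (rapidlyDecaying_snd rapidlyDecaying_gseDensity)
    (fun p => ?_) x y
  have := rayPoint_ne_zero p.1
  have := rayPoint_ne_zero p.2
  have := rayPoint_add_ne_zero p.1 p.2
  simp only [gseDensity]
  field_simp

lemma gse22_eq (x y : ℝ) : gse22 x y =
    gseConst * gseLaplace (fun p => rayPoint p.1 * (rayPoint p.2 * gseDensity p)) x y := by
  refine airyDoubleIntegral_eq _ _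
    (rapidlyDecaying_fst (rapidlyDecaying_snd rapidlyDecaying_gseDensity)) (fun p => ?_) x y
  have := rayPoint_ne_zero p.1
  have := rayPoint_ne_zero p.2
  have := rayPoint_add_ne_zero p.1 p.2
  simp only [gseDensity]
  field_simp

/-! ### Reality and antisymmetry of the GSE kernel -/

lemma gseDensity_neg (p : ℝ × ℝ) : gseDensity (-p) = (starRingEnd ℂ) (gseDensity p) := by
  simp only [gseDensity, Prod.fst_neg, Prod.snd_neg, rayPoint_neg, rayWeight_neg, map_mul,
    map_div₀, map_sub, map_add, map_ofNat]
  ring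

lemma gseDensity_swap (p : ℝ × ℝ) : gseDensity p.swap = -gseDensity p := by
  simp only [gseDensity, Prod.fst_swap, Prod.snd_swap]
  rw [← neg_sub (rayPoint p.1), neg_div, neg_mul, mul_comm (rayWeight p.2),
    add_comm (rayPoint p.2), mul_right_comm 4]

/-- Conjugation maps the contour to itself through `t ↦ -t`, so it can be undone by a change of
variables. -/
lemma conj_gseLaplace {f : ℝ × ℝ → ℂ} (hf : ∀ p, f (-p) = (starRingEnd ℂ) (f p)) (x y : ℝ) :
    (starRingEnd ℂ) (gseLaplace f x y) = gseLaplace f x y := by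
  simp only [gseLaplace, laplaceIntegral]
  rw [← integral_conj, ← integral_neg_eq_self]
  refine integral_congr_ae (Filter.Eventually.of_forall fun p => ?_)
  simp only [hf, map_mul, ← Complex.exp_conj, map_neg, map_add, Complex.conj_ofReal,
    Prod.fst_neg, Prod.snd_neg, rayPoint_neg, Complex.conj_conj]

lemma ofReal_re_gseConst_mul {f : ℝ × ℝ → ℂ} (hf : ∀ p, f (-p) = (starRingEnd ℂ) (f p))
    (x y : ℝ) : (((gseConst * gseLaplace f x y).re : ℝ) : ℂ) = gseConst * gseLaplace f x y := by
  rw [← Complex.conj_eq_iff_re, map_mul, Complex.conj_ofReal, conj_gseLaplace hf]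

lemma gse11_swap (x y : ℝ) : gse11 y x = -gse11 x y := by
  rw [gse11_eq, gse11_eq, ← mul_neg]
  congr 1
  simp only [gseLaplace, laplaceIntegral]
  rw [← integral_neg, Measure.volume_eq_prod, ← integral_prod_swap]
  refine integral_congr_ae (Filter.Eventually.of_forall fun p => ?_)
  simp only [gseDensity_swap, Prod.fst_swap, Prod.snd_swap, mul_neg]
  rw [add_comm]

lemma ofReal_kernelGSE (x y : ℝ) (i j : Fin 2) :
    ((kernelGSE x y i j : ℝ) : ℂ) = gseContourKernel x y i j := by
  have h12 : ∀ x y, ((gse12 x y).re : ℂ) = gse12 x y := fun x y => by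
    rw [gse12_eq]
    exact ofReal_re_gseConst_mul (fun p => by
      rw [gseDensity_neg, Prod.snd_neg, rayPoint_neg, map_mul]) x y
  fin_cases i <;> fin_cases j
  · change ((gse11 x y).re : ℂ) = gse11 x y
    rw [gse11_eq]
    exact ofReal_re_gseConst_mul gseDensity_neg x y
  · exact h12 x y
  · change ((-gse12 y x).re : ℂ) = -gse12 y x
    rw [Complex.neg_re, Complex.ofReal_neg, h12]
  · change ((gse22 x y).re : ℂ) = gse22 x y
    rw [gse22_eq]
    exact ofReal_re_gseConst_mul (fun p => by
      rw [gseDensity_neg, Prod.snd_neg, Prod.fst_neg, rayPoint_neg, rayPoint_neg, map_mul,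
        map_mul]) x y

lemma scalarGSE_eq (x y : ℝ) : scalarGSE x y = (gse11 x y).re := rfl

lemma scalarGSE_swap (x y : ℝ) : scalarGSE x y = -scalarGSE y x := by
  rw [scalarGSE_eq, scalarGSE_eq, gse11_swap x y, Complex.neg_re, neg_neg]

lemma contDiff_scalarGSE : ContDiff ℝ ∞ fun p : ℝ × ℝ => scalarGSE p.1 p.2 := by
  simp only [scalarGSE_eq, gse11_eq]
  exact Complex.reCLM.contDiff.comp (contDiff_const.mul
    (contDiff_laplaceIntegral rapidlyDecaying_gseDensity
      continuous_rayPoint_fst.aestronglyMeasurable continuous_rayPoint_snd.aestronglyMeasurable))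

lemma partialX_re_gseLaplace {f : ℝ × ℝ → ℂ}
    (hf : RapidlyDecaying volume (fun p : ℝ × ℝ => rayPoint p.1) (fun p => rayPoint p.2) f)
    (x y : ℝ) : partialX (fun x y => (gseConst * gseLaplace f x y).re) x y =
      -(gseConst * gseLaplace (fun p => rayPoint p.1 * f p) x y).re := by
  have h := (hasDerivAt_laplaceIntegral_left hf continuous_rayPoint_fst.aestronglyMeasurable
    continuous_rayPoint_snd.aestronglyMeasurable x y).const_mul (gseConst : ℂ)
  have h2 := Complex.reCLM.hasFDerivAt.comp_hasDerivAt x h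
  refine h2.deriv.trans ?_
  rw [mul_neg, Complex.reCLM_apply, Complex.neg_re]
  rfl

lemma partialY_re_gseLaplace {f : ℝ × ℝ → ℂ}
    (hf : RapidlyDecaying volume (fun p : ℝ × ℝ => rayPoint p.1) (fun p => rayPoint p.2) f)
    (x y : ℝ) : partialY (fun x y => (gseConst * gseLaplace f x y).re) x y =
      -(gseConst * gseLaplace (fun p => rayPoint p.2 * f p) x y).re := by
  have h := (hasDerivAt_laplaceIntegral_right hf continuous_rayPoint_fst.aestronglyMeasurable
    continuous_rayPoint_snd.aestronglyMeasurable x y).const_mul (gseConst : ℂ)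
  have h2 := Complex.reCLM.hasFDerivAt.comp_hasDerivAt y h
  refine h2.deriv.trans ?_
  rw [mul_neg, Complex.reCLM_apply, Complex.neg_re]
  rfl

lemma partialY_scalarGSE (x y : ℝ) : partialY scalarGSE x y = -(gse12 x y).re := by
  have h : scalarGSE = fun x y => (gseConst * gseLaplace gseDensity x y).re := by
    ext x y
    rw [scalarGSE_eq, gse11_eq]
  rw [h, partialY_re_gseLaplace rapidlyDecaying_gseDensity, gse12_eq]

/-- Differentiation in `y` or `x` cancels the factor `w` or `z` in the denominator of the density of
the entry `11`. -/
lemma kernelGSE_eq_kernelA : kernelGSE = kernelA scalarGSE := by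
  ext x y i j
  fin_cases i <;> fin_cases j
  · rfl
  · change (gse12 x y).re = -partialY scalarGSE x y
    rw [partialY_scalarGSE, neg_neg]
  · change (-gse12 y x).re = -partialX scalarGSE x y
    rw [partialX_eq_neg_partialY scalarGSE_swap, partialY_scalarGSE, Complex.neg_re, neg_neg]
  · change (gse22 x y).re = partialX (partialY scalarGSE) x y
    have h : partialY scalarGSE = fun x y => -(gseConst *
        gseLaplace (fun p => rayPoint p.2 * gseDensity p) x y).re := by
      ext x y
      rw [partialY_scalarGSE, gse12_eq]
    have h2 := partialX_re_gseLaplace (rapidlyDecaying_snd rapidlyDecaying_gseDensity) x y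
    rw [h, gse22_eq]
    rw [partialX] at h2 ⊢
    rw [deriv.fun_neg, h2, neg_neg]

/-! ### Exponential decay of the GSE kernel -/

lemma exists_abs_re_gseLaplace_lt {f : ℝ × ℝ → ℂ}
    (hf : RapidlyDecaying volume (fun p : ℝ × ℝ => rayPoint p.1) (fun p => rayPoint p.2) f)
    (x₀ : ℝ) : ∃ C : ℝ, 0 < C ∧ ∀ x ∈ Set.Ioi x₀, ∀ y ∈ Set.Ioi x₀,
      |(gseConst * gseLaplace f x y).re| < C * Real.exp (-x - y) := by
  let I : ℝ := ∫ p : ℝ × ℝ, Real.exp (|x₀| * (‖rayPoint p.1‖ + ‖rayPoint p.2‖)) * ‖f p‖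
  have hI : 0 ≤ I := integral_nonneg fun p => by positivity
  refine ⟨|gseConst| * (Real.exp (2 * x₀) * I) + 1, by positivity, fun x hx y hy => ?_⟩
  have h := norm_laplaceIntegral_le hf (fun p => one_le_re_rayPoint p.1)
    (fun p => one_le_re_rayPoint p.2) (le_of_lt hx) (le_of_lt hy)
  have hexp : Real.exp (2 * x₀ - x - y) = Real.exp (2 * x₀) * Real.exp (-x - y) := by
    rw [← Real.exp_add]; congr 1; ring
  calc |(gseConst * gseLaplace f x y).re| ≤ ‖(gseConst : ℂ) * gseLaplace f x y‖ :=
        Complex.abs_re_le_norm _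
    _ = |gseConst| * ‖gseLaplace f x y‖ := by
        rw [norm_mul, Complex.norm_real, Real.norm_eq_abs]
    _ ≤ |gseConst| * (Real.exp (2 * x₀ - x - y) * I) := by gcongr; exact h
    _ = |gseConst| * (Real.exp (2 * x₀) * I) * Real.exp (-x - y) := by rw [hexp]; ring
    _ < _ := by
        rw [add_mul, one_mul]
        exact lt_add_of_pos_right _ (Real.exp_pos _)

lemma expDecayOn_kernelGSE (x₀ : ℝ) : ExpDecayOn kernelGSE (Set.Ioi x₀) := by
  obtain ⟨C₁, hC₁, h₁⟩ := exists_abs_re_gseLaplace_lt rapidlyDecaying_gseDensity x₀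
  obtain ⟨C₂, hC₂, h₂⟩ :=
    exists_abs_re_gseLaplace_lt (rapidlyDecaying_snd rapidlyDecaying_gseDensity) x₀
  obtain ⟨C₃, hC₃, h₃⟩ := exists_abs_re_gseLaplace_lt
    (rapidlyDecaying_fst (rapidlyDecaying_snd rapidlyDecaying_gseDensity)) x₀
  have e : ∀ x ∈ Set.Ioi x₀, Real.exp (-x) ≤ Real.exp (-x₀) := fun x hx =>
    Real.exp_le_exp.2 (neg_le_neg (le_of_lt hx))
  have h0 := Real.exp_pos (-x₀)
  -- All entries are `O(e^{-x-y})`, so `a = 1` and `b = 0` work once the superfluous factors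
  -- `e^{-x}`, `e^{-y}` in the entries `12` and `22` are bounded by `e^{-x₀}`.
  refine ⟨C₁ + C₂ * Real.exp (-x₀) + C₃ * (Real.exp (-x₀) * Real.exp (-x₀)), 1, 0,
    by positivity, le_rfl, one_pos, fun x hx y hy => ⟨?_, ?_, ?_⟩⟩
  · change |(gse11 x y).re| < _
    rw [gse11_eq, neg_one_mul, one_mul]
    refine (h₁ x hx y hy).trans_le ?_
    gcongr
    rw [add_assoc]
    exact le_add_of_nonneg_right (by positivity)
  · change |(gse12 x y).re| < _
    rw [gse12_eq, neg_one_mul, zero_mul, add_zero]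
    refine (h₂ x hx y hy).trans_le ?_
    rw [sub_eq_add_neg, Real.exp_add]
    calc _ ≤ C₂ * (Real.exp (-x) * Real.exp (-x₀)) := by gcongr C₂ * (_ * ?_); exact e y hy
      _ = C₂ * Real.exp (-x₀) * Real.exp (-x) := by ring
      _ ≤ _ := by
        gcongr
        linarith [show 0 ≤ C₃ * (Real.exp (-x₀) * Real.exp (-x₀)) by positivity]
  · change |(gse22 x y).re| < _
    rw [gse22_eq, zero_mul, zero_mul, add_zero, Real.exp_zero, mul_one]
    refine (h₃ x hx y hy).trans_le ?_
    rw [sub_eq_add_neg, Real.exp_add]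
    calc _ ≤ C₃ * (Real.exp (-x₀) * Real.exp (-x₀)) := by
          gcongr
          · exact le_of_lt hx
          · exact le_of_lt hy
      _ ≤ _ := by
        linarith [show 0 ≤ C₂ * Real.exp (-x₀) by positivity]

end GSE

end FredholmPf

end

theorem mainTheorem4 :
    (∀ A : ℝ → ℝ → ℝ, ContDiff ℝ ∞ (fun p : ℝ × ℝ => A p.1 p.2) →
      (∀ x y : ℝ, A x y = -A y x) →
      ∀ x₀ : ℝ, FredholmPf.ExpDecayOn (FredholmPf.kernelA A) (Set.Ioi x₀) →
        FredholmPf.FredholmConverges (-FredholmPf.kernelA A) (Set.Ioi x₀) ∧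
        (-FredholmPf.kernelB A).FredholmConverges (Set.Ioi x₀) ∧
        FredholmPf.fredholmPfaffian (-FredholmPf.kernelA A) (Set.Ioi x₀) =
          (-FredholmPf.kernelB A).fredholmPfaffian (Set.Ioi x₀)) ∧
    (∀ (x y : ℝ) (i j : Fin 2),
      ((FredholmPf.kernelGSE x y i j : ℝ) : ℂ) = FredholmPf.gseContourKernel x y i j) ∧
    ContDiff ℝ ∞ (fun p : ℝ × ℝ => FredholmPf.scalarGSE p.1 p.2) ∧
    (∀ x y : ℝ, FredholmPf.scalarGSE x y = -FredholmPf.scalarGSE y x) ∧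
    FredholmPf.kernelGSE = FredholmPf.kernelA FredholmPf.scalarGSE ∧
    ∀ x₀ : ℝ,
      FredholmPf.FredholmConverges (-FredholmPf.kernelGSE) (Set.Ioi x₀) ∧
      (-FredholmPf.kernelInfinity).FredholmConverges (Set.Ioi x₀) ∧
      FredholmPf.fredholmPfaffian (-FredholmPf.kernelGSE) (Set.Ioi x₀) =
        (-FredholmPf.kernelInfinity).fredholmPfaffian (Set.Ioi x₀) := by
  refine ⟨fun A hA hA' x₀ h => FredholmPf.fredholmPfaffian_kernelA_eq_kernelB hA hA' h,
    FredholmPf.ofReal_kernelGSE, FredholmPf.contDiff_scalarGSE, FredholmPf.scalarGSE_swap,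
    FredholmPf.kernelGSE_eq_kernelA, fun x₀ => ?_⟩
  have h := FredholmPf.fredholmPfaffian_kernelA_eq_kernelB FredholmPf.contDiff_scalarGSE
    FredholmPf.scalarGSE_swap
    (FredholmPf.kernelGSE_eq_kernelA ▸ FredholmPf.expDecayOn_kernelGSE x₀)
  rwa [← FredholmPf.kernelGSE_eq_kernelA] at h
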